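/- Let $X$ be a real Banach space, $(\Omega,\mathcal A,\mathbb P)$ a probability space, $T>0$, and let $(w_t)_{t\in[0,T]}$ be a standard real Brownian motion on it with continuous paths, with natural filtration $\mathcal F_t=\sigma(w_r:0\le r\le t)$. **Birkhoff integral.** Let $\nu$ be a finite (countably additive) measure and $A$ a measurable set. A function $f$ with values in $X$ is *$Bi_1$-integrable on $A$* with respect to $\nu$, with integral $J\in X$, if for every $\varepsilon>0$ there is a finite or countable partition $P_\varepsilon$ of $A$ into measurable sets such that for every finite or countable measurable partition $(U_n)_n$ of $A$ finer than $P_\varepsilon$ and all $\omega_n\in U_n$ one has $\limsup_n\big\|\sum_{k=1}^n f(\omega_k)\nu(U_k)-J\big\|<\varepsilon$ (for a finite partition the sums stop at its last member). We write $J=(Bi_1)\int_A f\,d\nu$. **Stochastic Birkhoff integral.** A function $\Phi$ from $[0,T]$ to $X$ is *$Bi_1^\star$-integrable* with respect to $w$ if it is differentiable on $[0,T]$ (one-sidedly at the end points), with derivative $\Phi'$, and for every $\omega\in\Omega$ the function $r\mapsto \Phi'(r)\,w_r(\omega)$ is $Bi_1$-integrable on $[0,T]$ with respect to Lebesgue measure.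 In this case, for $0\le a\le b\le T$, $$(Bi_1^\star)\int_a^b\Phi(r)\,dw_r=\Phi(b)w_b-\Phi(a)w_a-(Bi_1)\int_{[a,b]}\Phi'(r)w_r\,dr .$$ **Martingales.** An $X$-valued process $(A_t)_{t\in[0,T]}$ (a strongly measurable function on $[0,T]\times\Omega$) is a *martingale* with respect to $(\mathcal F_t)$ if every $A_t$ is strongly $\mathcal F_t$-measurable and $Bi_1$-integrable on $\Omega$ with respect to $\mathbb P$, and $\mathbb E(A_t\mid\mathcal F_s)=A_s$ for all $s\le t$ in $[0,T]$, that is, $(Bi_1)\int_E A_t\,d\mathbb P=(Bi_1)\int_E A_s\,d\mathbb P$ for every $E\in\mathcal F_s$. **Theorem.** Let $\Phi:[0,T]\to X$ be $Bi_1^\star$-integrable with respect to $w$. Suppose moreover that $\Phi$ is strongly measurable and differentiable on $[0,T]$ and that, for every $x^*\in X^*$, the function $\langle x^*,\Phi(\cdot)\rangle$ belongs to $L^2([0,T])$ and satisfies $\frac{d}{dt}\langle x^*,\Phi(t)\rangle=\langle x^*,\Phi'(t)\rangle$ on $[0,T]$. Then the $X$-valued process $$A_t=(Bi_1^\star)\int_0^t\Phi(s)\,dw_s,\qquad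 t\in[0,T],$$ is a martingale with respect to the natural filtration $(\mathcal F_t)_{t\in[0,T]}$ of $(w_t)_t$. -/

import Mathlib

open MeasureTheory ProbabilityTheory Set Filter Topology
open scoped ENNReal NNReal

noncomputable section

/-! ### The first type Birkhoff integral -/

section Birkhoff

variable {α X : Type*} [MeasurableSpace α] [NormedAddCommGroup X] [NormedSpace ℝ X]

/-- `U` is a finite or countable partition of the set `A` into measurable sets. A finite family is
represented by a sequence that is padded with empty sets; only the non-empty members count. -/
structure IsMeasurablePartition (A : Set α) (U : ℕ → Set α) : Prop where
  measurableSet : ∀ n, MeasurableSet (U n)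
  disjoint : ∀ m n, m ≠ n → Disjoint (U m) (U n)
  cover : ⋃ n, U n = A

/-- The partition `U` is finer than the partition `V`. -/
def IsFinerPartition (U V : ℕ → Set α) : Prop :=
  ∀ n, ∃ m, U n ⊆ V m

/-- `J` is the first type Birkhoff integral over `A` of `f : α → X` with respect to the finite
measure `ν`. The upper limit is taken in `[0, ∞]`, so it is infinite when the partial sums are
unbounded. Tags are only constrained in non-empty members of the partition; empty members
contribute zero to the sums. -/
def HasBirkhoffIntegral (ν : Measure α) [IsFiniteMeasure ν] (f : α → X) (A : Set α) (J : X) :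
    Prop :=
  ∀ ε : ℝ, 0 < ε → ∃ V : ℕ → Set α, IsMeasurablePartition A V ∧
    ∀ U : ℕ → Set α, IsMeasurablePartition A U → IsFinerPartition U V →
      ∀ x : ℕ → α, (∀ n, (U n).Nonempty → x n ∈ U n) →
        limsup (fun n : ℕ => ‖(∑ k ∈ Finset.range n, ν.real (U k) • f (x k)) - J‖ₑ) atTop
          < ENNReal.ofReal ε

/-- `f` is first type Birkhoff integrable over `A` with respect to `ν`. -/
def BirkhoffIntegrable (ν : Measure α) [IsFiniteMeasure ν] (f : α → X) (A : Set α) : Prop :=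
  ∃ J : X, HasBirkhoffIntegral ν f A J

open Classical in
/-- The first type Birkhoff integral over `A` (zero if `f` is not integrable over `A`). -/
def birkhoffIntegral (ν : Measure α) [IsFiniteMeasure ν] (f : α → X) (A : Set α) : X :=
  if h : BirkhoffIntegrable ν f A then h.choose else 0

theorem exists_common_refinement {A : Set α} {V W : ℕ → Set α}
    (hV : IsMeasurablePartition A V) (hW : IsMeasurablePartition A W) :
    ∃ U : ℕ → Set α, IsMeasurablePartition A U ∧ IsFinerPartition U V ∧ IsFinerPartition U W := by
  refine ⟨fun n => V n.unpair.1 ∩ W n.unpair.2, ⟨fun n => (hV.1 _).inter (hW.1 _), ?_, ?_⟩,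
    fun n => ⟨_, inter_subset_left⟩, fun n => ⟨_, inter_subset_right⟩⟩
  · intro m n hmn
    by_cases h1 : m.unpair.1 = n.unpair.1
    · have h2 : m.unpair.2 ≠ n.unpair.2 := fun h2 => hmn (by
        rw [← Nat.pair_unpair m, ← Nat.pair_unpair n, h1, h2])
      exact (hW.2 _ _ h2).mono inter_subset_right inter_subset_right
    · exact (hV.2 _ _ h1).mono inter_subset_left inter_subset_left
  · ext a
    simp only [mem_iUnion, mem_inter_iff]
    constructor
    · rintro ⟨n, h, -⟩
      rw [← hV.3]
      exact mem_iUnion.2 ⟨_, h⟩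
    · intro ha
      obtain ⟨i, hi⟩ := mem_iUnion.1 (hV.3.symm ▸ ha : a ∈ ⋃ n, V n)
      obtain ⟨j, hj⟩ := mem_iUnion.1 (hW.3.symm ▸ ha : a ∈ ⋃ n, W n)
      exact ⟨Nat.pair i j, by simpa using ⟨hi, hj⟩⟩

/-- The Birkhoff integral is unique. -/
theorem HasBirkhoffIntegral.unique [Nonempty α] {ν : Measure α} [IsFiniteMeasure ν] {f : α → X}
    {A : Set α} {J K : X} (hJ : HasBirkhoffIntegral ν f A J) (hK : HasBirkhoffIntegral ν f A K) :
    J = K := by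
  by_contra hne
  have hpos : 0 < ‖J - K‖ / 2 := half_pos (norm_pos_iff.2 (sub_ne_zero.2 hne))
  obtain ⟨V, hV, hV'⟩ := hJ _ hpos
  obtain ⟨W, hW, hW'⟩ := hK _ hpos
  obtain ⟨U, hU, hUV, hUW⟩ := exists_common_refinement hV hW
  classical
  let x : ℕ → α := fun n => if h : (U n).Nonempty then h.some else Classical.arbitrary α
  have hx : ∀ n, (U n).Nonempty → x n ∈ U n := fun n h => by
    simp only [x, dif_pos h]
    exact h.some_mem
  have h1 := eventually_lt_of_limsup_lt (hV' U hU hUV x hx)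
  have h2 := eventually_lt_of_limsup_lt (hW' U hU hUW x hx)
  obtain ⟨n, h1, h2⟩ := (h1.and h2).exists
  rw [← ofReal_norm, ENNReal.ofReal_lt_ofReal_iff hpos] at h1 h2
  set S := ∑ k ∈ Finset.range n, ν.real (U k) • f (x k)
  have h3 : ‖J - K‖ ≤ ‖S - J‖ + ‖S - K‖ := by
    have h4 := norm_sub_le (S - K) (S - J)
    have h5 : S - K - (S - J) = J - K := by abel
    rw [h5] at h4
    linarith
  linarith

theorem HasBirkhoffIntegral.birkhoffIntegral_eq [Nonempty α] {ν : Measure α} [IsFiniteMeasure ν]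
    {f : α → X} {A : Set α} {J : X} (hJ : HasBirkhoffIntegral ν f A J) :
    birkhoffIntegral ν f A = J := by
  have h : BirkhoffIntegrable ν f A := ⟨J, hJ⟩
  rw [birkhoffIntegral, dif_pos h]
  exact h.choose_spec.unique hJ

end Birkhoff

/-! ### Conditional expectations and martingales in the Birkhoff sense -/

section Martingale

variable {Ω X : Type*} [NormedAddCommGroup X] [NormedSpace ℝ X]

/-- `Ψ` is a conditional expectation of `Φ` given the sub-σ-algebra `m`, in the sense of the first
type Birkhoff integral. -/
structure IsBirkhoffCondExp (m : MeasurableSpace Ω) {mΩ : MeasurableSpace Ω} (P : Measure Ω)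
    [IsFiniteMeasure P] (Φ Ψ : Ω → X) : Prop where
  integrable_left : BirkhoffIntegrable P Φ univ
  stronglyMeasurable : StronglyMeasurable[m] Ψ
  integrable_right : BirkhoffIntegrable P Ψ univ
  integral_eq : ∀ E : Set Ω, MeasurableSet[m] E → birkhoffIntegral P Φ E = birkhoffIntegral P Ψ E

/-- The `X`-valued process `A` is a martingale with respect to `P` and the filtration `ℱ`: it is a
process (jointly strongly measurable), it is adapted, every `A t` is first type Birkhoff integrable,
and `A s` is a conditional expectation of `A t` given `ℱ s` for `s ≤ t`. -/
structure IsBirkhoffMartingale {ι : Type*} [Preorder ι] [MeasurableSpace ι]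
    {mΩ : MeasurableSpace Ω} (P : Measure Ω) [IsFiniteMeasure P] (ℱ : Filtration ι mΩ) (A : ι → Ω → X) : Prop where
  process : StronglyMeasurable (fun p : ι × Ω => A p.1 p.2)
  adapted : ∀ t, StronglyMeasurable[ℱ t] (A t)
  integrable : ∀ t, BirkhoffIntegrable P (A t) univ
  condExp : ∀ s t, s ≤ t → IsBirkhoffCondExp (ℱ s) P (A t) (A s)

end Martingale

/-! ### Brownian motion on `[0, T]` and the stochastic Birkhoff integral -/

section Stochastic

variable {Ω X : Type*} {mΩ : MeasurableSpace Ω} [NormedAddCommGroup X] [NormedSpace ℝ X] {T : ℝ}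

/-- Standard real Brownian motion `(w t)`, `t ∈ [0, T]`, with continuous paths. -/
structure IsBrownianMotion (w : Icc (0 : ℝ) T → Ω → ℝ) (P : Measure Ω) : Prop where
  measurable : ∀ t, Measurable (w t)
  start : ∀ t : Icc (0 : ℝ) T, (t : ℝ) = 0 → ∀ᵐ ω ∂P, w t ω = 0
  indepIncrements : HasIndepIncrements w P
  law_increment : ∀ s t : Icc (0 : ℝ) T, s ≤ t →
    HasLaw (fun ω => w t ω - w s ω) (gaussianReal 0 (Real.toNNReal ((t : ℝ) - s))) P
  continuous_paths : ∀ ω, Continuous (fun t => w t ω)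

/-- The natural filtration of a Brownian motion: at time `t` it is generated by all `w s`,
`s ≤ t`. -/
def IsBrownianMotion.naturalFiltration {w : Icc (0 : ℝ) T → Ω → ℝ} {P : Measure Ω}
    (hw : IsBrownianMotion w P) : Filtration (Icc (0 : ℝ) T) mΩ :=
  Filtration.natural w (fun t => (hw.measurable t).stronglyMeasurable)

/-- Lebesgue measure on `[0, T]`. -/
def lebesgueOn (T : ℝ) : Measure (Icc (0 : ℝ) T) :=
  (volume : Measure ℝ).comap Subtype.val

instance lebesgueOn.isFiniteMeasure (T : ℝ) : IsFiniteMeasure (lebesgueOn T) := by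
  refine ⟨?_⟩
  rw [lebesgueOn, (MeasurableEmbedding.subtype_coe measurableSet_Icc).comap_apply, image_univ,
    Subtype.range_coe]
  exact measure_Icc_lt_top

/-- The path `r ↦ w r ω • Φ' r` on `[0, T]`, where `Φ'` is the derivative of `Φ` relative
to `[0, T]` (one-sided at the end points). -/
def derivTimesPath (Φ : ℝ → X) (w : Icc (0 : ℝ) T → Ω → ℝ) (ω : Ω) : Icc (0 : ℝ) T → X :=
  fun r => w r ω • derivWithin Φ (Icc 0 T) (r : ℝ)

/-- `Φ` is stochastic Birkhoff integrable with respect to `w`. -/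
structure BiStarIntegrable (Φ : ℝ → X) (w : Icc (0 : ℝ) T → Ω → ℝ) : Prop where
  differentiableOn : DifferentiableOn ℝ Φ (Icc 0 T)
  integrable : ∀ ω, BirkhoffIntegrable (lebesgueOn T) (derivTimesPath Φ w ω) univ

/-- The stochastic Birkhoff integral of `Φ` over `[a, b] ⊆ [0, T]` with respect to `w`. -/
def biStarIntegral (Φ : ℝ → X) (w : Icc (0 : ℝ) T → Ω → ℝ) (a b : Icc (0 : ℝ) T) (ω : Ω) : X :=
  w b ω • Φ b - w a ω • Φ a -
    birkhoffIntegral (lebesgueOn T) (derivTimesPath Φ w ω) (Icc a b)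

/-- `Φ` is strongly measurable and differentiable on `[0, T]`, and every scalar function `x* ∘ Φ`
is square integrable on `[0, T]` and has derivative `x* ∘ Φ'`. -/
structure DualDifferentiable (T : ℝ) (Φ : ℝ → X) : Prop where
  stronglyMeasurable : StronglyMeasurable (fun t : Icc (0 : ℝ) T => Φ t)
  differentiableOn : DifferentiableOn ℝ Φ (Icc 0 T)
  memLp_two : ∀ φ : X →L[ℝ] ℝ,
    MemLp (fun t : Icc (0 : ℝ) T => φ (Φ t)) 2 (lebesgueOn T)
  hasDeriv : ∀ φ : X →L[ℝ] ℝ, ∀ t ∈ Icc (0 : ℝ) T,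
    HasDerivWithinAt (fun r => φ (Φ r)) (φ (derivWithin Φ (Icc 0 T) t)) (Icc 0 T) t

end Stochastic

end

/-!
The process is `A t = w t • Φ t - w 0 • Φ 0 - Z t` with `Z t ω` the Birkhoff integral of
`w r ω • Φ' r` over `[0, t]`. All functions that occur are strongly measurable, and for such
functions Birkhoff integrability on a finite measure space is equivalent to uniform
integrability of the functions `φ ∘ f`, `‖φ‖ ≤ 1` (`DualUniformlyIntegrable`); the Birkhoff
integral over any measurable set is then the weak (Pettis) integral. This is
`BirkhoffIntegrable.dualUniformlyIntegrable` and
`DualUniformlyIntegrable.exists_hasBirkhoffIntegral`, and it reduces the theorem to scalar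
statements about `φ ∘ A t`.

The hypothesis gives this uniform integrability for `w r ω • Φ' r`, separately for each path.
Since `w r` has the law of `√r` times a standard Gaussian variable, it follows for `√r • Φ' r`
(`IsBrownianMotion.dualUniformlyIntegrable_sqrt_smul`). With the bound `E (|w r|; E) ≤ √(r * P E)`
and Tonelli's theorem, `Z t` is uniformly integrable over the dual ball on `Ω`, so that `A t` is
Birkhoff integrable, and the order of integration may be exchanged in the integral of `φ ∘ Z t`
over an event.

Measurability of `Z`, jointly and with respect to the filtration, comes from the Pettis
measurability theorem `stronglyMeasurable_of_dual_apply`.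

For `s ≤ t` and `E` in the past of `s`, the integral of `w r` over `E` is the same number `m` for
all `r ≥ s`. The integral of `φ (A t - A s)` over `E` is therefore `m` times
`φ (Φ t) - φ (Φ s) - ∫ₛᵗ φ (Φ' r) dr`. For `s > 0` the bracket vanishes by the
fundamental theorem of calculus: `φ ∘ Φ` is differentiable everywhere and its derivative is
integrable on `[s, t]`. For `s = 0` the derivative need not be integrable, but `m = 0`
because `w 0 = 0` almost surely.
-/

/-! ### Birkhoff integrability and uniform integrability over the dual ball -/

section BirkhoffTheory

variable {α X : Type*} [MeasurableSpace α] [NormedAddCommGroup X] [NormedSpace ℝ X]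

/-- If the partial sums of every reordering of a series, padded with zeros, are eventually within
`ε` of `J`, then so are all finite sums containing a fixed finite one. Otherwise there is an
increasing exhaustion of `ℕ` by finite sets with bad sums, and a reordering that lists these sets
one after the other has infinitely many bad partial sums. -/
theorem exists_finset_forall_superset_norm_sum_sub_lt {X : Type*} [NormedAddCommGroup X]
    {a : ℕ → X} {J : X} {ε : ℝ}
    (h : ∀ p : ℕ → ℕ, Function.Injective p →
      ∀ᶠ n in atTop, ‖∑ k ∈ Finset.range n, Function.extend p a 0 k - J‖ < ε) :
    ∃ F₀ : Finset ℕ, ∀ F, F₀ ⊆ F → ‖∑ k ∈ F, a k - J‖ < ε := by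
  classical
  by_contra! hcon
  -- `H j` is the exhaustion, `M (j + 1)` the position at which the enumeration of `H j` ends
  choose G hG hGε using hcon
  let H : ℕ → Finset ℕ := fun n => Nat.rec ∅ (fun j F => G (insert j F)) n
  have hH : ∀ j, H (j + 1) = G (insert j (H j)) := fun j => rfl
  have hmono : Monotone H := by
    refine monotone_nat_of_le_succ fun j => ?_
    rw [hH]
    exact (Finset.subset_insert _ _).trans (hG _)
  have hex : ∀ k, ∃ j, k ∈ H j := fun k =>
    ⟨k + 1, by rw [hH]; exact hG _ (Finset.mem_insert_self _ _)⟩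
  let M : ℕ → ℕ := fun n => Nat.rec 0 (fun j m => m + (H j).sup id + 1) n
  have hM : ∀ j, M (j + 1) = M j + (H j).sup id + 1 := fun j => rfl
  have hMmono : StrictMono M := strictMono_nat_of_lt_succ fun j => by rw [hM]; omega
  have hleast : ∀ k, ∃ j, k ∈ H j ∧ ∀ i, k ∈ H i → j ≤ i := fun k =>
    ⟨sInf {j | k ∈ H j}, Nat.sInf_mem (hex k), fun i hi => Nat.sInf_le hi⟩
  choose j₀ hj₀ hj₀_le using hleast
  let p : ℕ → ℕ := fun k => M (j₀ k) + k
  -- the initial segment `[0, M (j + 1))` of the new order consists of the members of `H j`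
  have hin : ∀ j k, k ∈ H j → p k < M (j + 1) := fun j k hk => by
    have h1 : k ≤ (H (j₀ k)).sup id := Finset.le_sup (f := id) (hj₀ k)
    have h2 : M (j₀ k + 1) ≤ M (j + 1) :=
      hMmono.monotone (Nat.succ_le_succ (hj₀_le k j hk))
    rw [hM] at h2
    simp only [p]
    omega
  have hout : ∀ j k, k ∉ H j → M (j + 1) ≤ p k := fun j k hk => by
    have h1 : j + 1 ≤ j₀ k := by
      by_contra! h2
      exact hk (hmono (Nat.lt_succ_iff.1 h2) (hj₀ k))
    exact (hMmono.monotone h1).trans (Nat.le_add_right _ _)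
  have hp : Function.Injective p := by
    have key : ∀ k l, j₀ k < j₀ l → p k < p l := fun k l hkl =>
      (hin _ k (hj₀ k)).trans_le (hout _ l fun h1 => (hj₀_le l _ h1).not_gt hkl)
    intro k l hkl
    rcases lt_trichotomy (j₀ k) (j₀ l) with h1 | h1 | h1
    · exact absurd hkl (key k l h1).ne
    · simpa [p, h1] using hkl
    · exact absurd hkl (key l k h1).ne'
  have hsum : ∀ j, ∑ k ∈ Finset.range (M (j + 1)), Function.extend p a 0 k = ∑ k ∈ H j, a k := by
    intro j
    rw [← Finset.sum_subset (s₁ := (H j).image p), Finset.sum_image hp.injOn]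
    · exact Finset.sum_congr rfl fun k _ => hp.extend_apply _ _ _
    · intro n hn
      obtain ⟨k, hk, rfl⟩ := Finset.mem_image.1 hn
      exact Finset.mem_range.2 (hin j k hk)
    · intro n hn hn'
      by_cases hex' : ∃ k, p k = n
      · obtain ⟨k, rfl⟩ := hex'
        refine absurd (hout j k fun hk => hn' (Finset.mem_image_of_mem p hk)) ?_
        exact not_le.2 (Finset.mem_range.1 hn)
      · simp [Function.extend_apply' _ _ _ hex']
  have hlim : Tendsto (fun j => M (j + 2)) atTop atTop :=
    (hMmono.tendsto_atTop).comp (tendsto_add_atTop_nat 2)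
  obtain ⟨j, hj⟩ := (hlim.eventually (h p hp)).exists
  rw [hsum (j + 1), hH] at hj
  exact absurd hj (not_lt.2 (hGε _))

/-- The partial sums in the definition of the Birkhoff integral may be replaced by unordered finite
sums: since a partition may be listed in any order and padded with empty sets,
`exists_finset_forall_superset_norm_sum_sub_lt` applies to its Riemann sums. -/
theorem HasBirkhoffIntegral.exists_partition_finset {ν : Measure α} [IsFiniteMeasure ν] {f : α → X}
    {A : Set α} {J : X} (hJ : HasBirkhoffIntegral ν f A J) {ε : ℝ} (hε : 0 < ε) :
    ∃ V, IsMeasurablePartition A V ∧ ∀ U, IsMeasurablePartition A U → IsFinerPartition U V →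
      ∀ x : ℕ → α, (∀ n, (U n).Nonempty → x n ∈ U n) →
        ∃ F₀ : Finset ℕ, ∀ F, F₀ ⊆ F → ‖∑ k ∈ F, ν.real (U k) • f (x k) - J‖ < ε := by
  obtain ⟨V, hV, hV'⟩ := hJ ε hε
  refine ⟨V, hV, fun U hU hUV x hx => exists_finset_forall_superset_norm_sum_sub_lt
    fun p hp => ?_⟩
  have hcases : ∀ n, (∃ k, p k = n) ∨ Function.extend p U (fun _ => ∅) n = ∅ := fun n => by
    by_cases h : ∃ k, p k = n
    · exact Or.inl h
    · exact Or.inr (Function.extend_apply' _ _ _ h)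
  have hU' : IsMeasurablePartition A (Function.extend p U fun _ => ∅) := by
    refine ⟨fun n => ?_, fun m n hmn => ?_, ?_⟩
    · rcases hcases n with ⟨k, rfl⟩ | h
      · rw [hp.extend_apply]; exact hU.1 k
      · rw [h]; exact MeasurableSet.empty
    · rcases hcases n with ⟨k, rfl⟩ | h
      · rcases hcases m with ⟨l, rfl⟩ | h
        · rw [hp.extend_apply, hp.extend_apply]
          exact hU.2 _ _ fun h => hmn (by rw [h])
        · rw [h]; exact disjoint_bot_left
      · rw [h]; exact disjoint_bot_right
    · rw [← hU.3]
      refine Subset.antisymm (iUnion_subset fun n => ?_) (iUnion_subset fun k => ?_)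
      · rcases hcases n with ⟨k, rfl⟩ | h
        · rw [hp.extend_apply]; exact subset_iUnion U k
        · rw [h]; exact empty_subset _
      · rw [← hp.extend_apply U (fun _ => ∅) k]
        exact subset_iUnion (Function.extend p U fun _ => ∅) (p k)
  have hUV' : IsFinerPartition (Function.extend p U fun _ => ∅) V := fun n => by
    rcases hcases n with ⟨k, rfl⟩ | h
    · rw [hp.extend_apply]; exact hUV k
    · rw [h]; exact ⟨0, empty_subset _⟩
  have hx' : ∀ n, (Function.extend p U (fun _ => ∅) n).Nonempty →
      Function.extend p x (fun _ => x 0) n ∈ Function.extend p U (fun _ => ∅) n := fun n hn => by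
    rcases hcases n with ⟨k, rfl⟩ | h
    · rw [hp.extend_apply] at hn ⊢
      rw [hp.extend_apply]
      exact hx k hn
    · rw [h] at hn; exact absurd hn not_nonempty_empty
  have hterm : (fun n => ν.real (Function.extend p U (fun _ => ∅) n) •
      f (Function.extend p x (fun _ => x 0) n)) =
      Function.extend p (fun k => ν.real (U k) • f (x k)) 0 := by
    funext n
    rcases hcases n with ⟨k, rfl⟩ | h
    · simp only [hp.extend_apply]
    · by_cases h' : ∃ k, p k = n
      · obtain ⟨k, rfl⟩ := h'
        simp only [hp.extend_apply]
      · rw [h, measureReal_empty, zero_smul,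
          Function.extend_apply' (f := p) (fun k => ν.real (U k) • f (x k)) 0 n h', Pi.zero_apply]
  filter_upwards [eventually_lt_of_limsup_lt (hV' _ hU' hUV' _ hx')] with n hn
  rw [← ofReal_norm, ENNReal.ofReal_lt_ofReal_iff hε] at hn
  simpa only [← hterm] using hn

/-- A strongly measurable function has separable range, so its domain splits into countably many
measurable pieces on each of which it oscillates by at most `ε`. -/
theorem MeasureTheory.StronglyMeasurable.exists_partition_norm_sub_le {X : Type*}
    [NormedAddCommGroup X] {f : α → X}
    (hf : StronglyMeasurable f) {A : Set α} (hA : MeasurableSet A) {ε : ℝ} (hε : 0 < ε) :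
    ∃ V, IsMeasurablePartition A V ∧ ∀ n, ∀ x ∈ V n, ∀ y ∈ V n, ‖f x - f y‖ ≤ ε := by
  rcases isEmpty_or_nonempty α with hα | hα
  · exact ⟨fun _ => ∅, ⟨fun _ => MeasurableSet.empty, fun _ _ _ => disjoint_bot_left,
      by simpa using (Set.eq_empty_of_isEmpty A).symm⟩, fun n x => (hα.false x).elim⟩
  obtain ⟨c, hc, hcl⟩ := hf.isSeparable_range
  have hcne : c.Nonempty := by
    by_contra h
    rw [not_nonempty_iff_eq_empty.1 h, closure_empty] at hcl
    exact hcl (mem_range_self (Classical.arbitrary α))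
  obtain ⟨d, hd⟩ := hc.exists_eq_range hcne
  -- the pieces are preimages of balls around a dense sequence, made disjoint
  let B : ℕ → Set α := fun n => {x | ‖f x - d n‖ < ε / 2}
  have hB : ∀ n, MeasurableSet (B n) := fun n =>
    (hf.sub stronglyMeasurable_const).norm.measurable measurableSet_Iio
  refine ⟨fun n => A ∩ disjointed B n, ⟨fun n => hA.inter (MeasurableSet.disjointed hB n),
    fun m n hmn => ((disjoint_disjointed B) hmn).mono inter_subset_right inter_subset_right, ?_⟩,
    fun n x hx y hy => ?_⟩
  · rw [← inter_iUnion, iUnion_disjointed, inter_eq_left]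
    intro x _
    obtain ⟨y, hy, hxy⟩ := Metric.mem_closure_iff.1 (hcl (mem_range_self x)) (ε / 2) (half_pos hε)
    rw [hd] at hy
    obtain ⟨n, rfl⟩ := hy
    exact mem_iUnion.2 ⟨n, by rwa [dist_eq_norm] at hxy⟩
  · have h1 : ‖f x - d n‖ < ε / 2 := disjointed_subset B n hx.2
    have h2 : ‖f y - d n‖ < ε / 2 := disjointed_subset B n hy.2
    rw [← sub_sub_sub_cancel_right (f x) (f y) (d n)]
    linarith [norm_sub_le (f x - d n) (f y - d n)]

/-- The family of the functions `φ ∘ f`, where `φ` runs through the closed unit ball of the dual, is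
uniformly integrable. The condition is on sets of small measure only; `L¹` bounds follow from it for
strongly measurable `f` (`DualUniformlyIntegrable.exists_lintegral_le`). -/
def DualUniformlyIntegrable (ν : Measure α) (f : α → X) : Prop :=
  ∀ ε : ℝ≥0∞, ε ≠ 0 → ∃ δ : ℝ≥0∞, δ ≠ 0 ∧ ∀ B, MeasurableSet B → ν B ≤ δ →
    ∀ φ : StrongDual ℝ X, ‖φ‖ ≤ 1 → ∫⁻ x in B, ‖φ (f x)‖ₑ ∂ν ≤ ε

theorem exists_mem_of_nonempty {α : Type*} [Nonempty α] (U : ℕ → Set α) :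
    ∃ x : ℕ → α, ∀ n, (U n).Nonempty → x n ∈ U n := by
  classical
  exact ⟨fun n => if h : (U n).Nonempty then h.some else Classical.arbitrary α, fun n h => by
    simpa only [dif_pos h] using h.some_mem⟩

theorem sum_abs_le_of_forall_abs_sum_le {b : ℕ → ℝ} {C : ℝ} {F : Finset ℕ}
    (h : ∀ G ⊆ F, |∑ k ∈ G, b k| ≤ C) : ∑ k ∈ F, |b k| ≤ 2 * C := by
  rw [← Finset.sum_filter_add_sum_filter_not F (fun k => 0 ≤ b k)]
  have h1 : ∑ k ∈ F with 0 ≤ b k, |b k| = ∑ k ∈ F with 0 ≤ b k, b k :=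
    Finset.sum_congr rfl fun k hk => abs_of_nonneg (Finset.mem_filter.1 hk).2
  have h2 : ∑ k ∈ F with ¬ 0 ≤ b k, |b k| = -∑ k ∈ F with ¬ 0 ≤ b k, b k := by
    rw [← Finset.sum_neg_distrib]
    exact Finset.sum_congr rfl fun k hk => abs_of_neg (not_le.1 (Finset.mem_filter.1 hk).2)
  rw [h1, h2]
  have h3 := h _ (Finset.filter_subset (fun k => 0 ≤ b k) F)
  have h4 := h _ (Finset.filter_subset (fun k => ¬ 0 ≤ b k) F)
  rw [abs_le] at h3 h4
  linarith

theorem StrongDual.norm_apply_le_of_norm_le_one {φ : StrongDual ℝ X} (hφ : ‖φ‖ ≤ 1) (x : X) :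
    ‖φ x‖ ≤ ‖x‖ :=
  (φ.le_opNorm x).trans (mul_le_of_le_one_left (norm_nonneg _) hφ)

theorem StrongDual.enorm_apply_le_of_norm_le_one {φ : StrongDual ℝ X} (hφ : ‖φ‖ ≤ 1) (x : X) :
    ‖φ x‖ₑ ≤ ‖x‖ₑ := by
  rw [← ofReal_norm, ← ofReal_norm]
  exact ENNReal.ofReal_le_ofReal (StrongDual.norm_apply_le_of_norm_le_one hφ x)

/-- On a partition where `f` oscillates by at most `1`, the Riemann sums outside a finite set `F₀`
of members are small uniformly over the dual unit ball. On the finitely many remaining members,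
`f` is bounded. -/
theorem BirkhoffIntegrable.dualUniformlyIntegrable {ν : Measure α} [IsFiniteMeasure ν] {f : α → X}
    (hf : StronglyMeasurable f) (h : BirkhoffIntegrable ν f univ) :
    DualUniformlyIntegrable ν f := by
  rcases isEmpty_or_nonempty α with hα | hα
  · exact fun ε _ => ⟨1, one_ne_zero, fun B _ _ φ _ => by
      simp [Measure.eq_zero_of_isEmpty ν]⟩
  obtain ⟨J, hJ⟩ := h
  intro ε hε
  obtain ⟨η, hη, hηε⟩ : ∃ η : ℝ, 0 < η ∧ ENNReal.ofReal (4 * η) ≤ ε / 2 := by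
    obtain ⟨r, hr, hr'⟩ := ENNReal.lt_iff_exists_nnreal_btwn.1 (ENNReal.half_pos hε)
    refine ⟨r / 4, div_pos (by exact_mod_cast hr) (by norm_num), ?_⟩
    rw [mul_div_cancel₀ _ (by norm_num), ENNReal.ofReal_coe_nnreal]
    exact hr'.le
  obtain ⟨V, hV, hV'⟩ := hJ.exists_partition_finset hη
  obtain ⟨W, hW, hW'⟩ := hf.exists_partition_norm_sub_le MeasurableSet.univ (zero_lt_one (α := ℝ))
  obtain ⟨U, hU, hUV, hUW⟩ := exists_common_refinement hV hW
  obtain ⟨x, hx⟩ := exists_mem_of_nonempty U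
  obtain ⟨F₀, hF₀⟩ := hV' U hU hUV x hx
  have hosc : ∀ n, ∀ y ∈ U n, ‖f y - f (x n)‖ ≤ 1 := fun n y hy => by
    obtain ⟨m, hm⟩ := hUW n
    exact hW' m y (hm hy) _ (hm (hx n ⟨y, hy⟩))
  -- finite sums avoiding `F₀` are small, uniformly over the dual ball
  have htail : ∀ φ : StrongDual ℝ X, ‖φ‖ ≤ 1 → ∀ F : Finset ℕ, Disjoint F F₀ →
      ∑ k ∈ F, |ν.real (U k) * φ (f (x k))| ≤ 4 * η := by
    intro φ hφ F hF
    -- a sum over `G` is the difference of two sums containing `F₀`, hence at most `2 * η`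
    have h4 : 4 * η = 2 * (2 * η) := by ring
    rw [h4]
    refine sum_abs_le_of_forall_abs_sum_le fun G hG => ?_
    have h1 : ∑ k ∈ G, ν.real (U k) * φ (f (x k)) =
        φ ((∑ k ∈ G ∪ F₀, ν.real (U k) • f (x k) - J) -
          (∑ k ∈ F₀, ν.real (U k) • f (x k) - J)) := by
      rw [sub_sub_sub_cancel_right, Finset.sum_union (hF.mono_left hG), add_sub_cancel_right,
        map_sum]
      simp
    rw [h1, ← Real.norm_eq_abs]
    refine (StrongDual.norm_apply_le_of_norm_le_one hφ _).trans ((norm_sub_le _ _).trans ?_)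
    linarith [hF₀ (G ∪ F₀) Finset.subset_union_right, hF₀ F₀ subset_rfl]
  have htail' : ∀ φ : StrongDual ℝ X, ‖φ‖ ≤ 1 →
      ∑' k, (if k ∈ F₀ then 0 else ν (U k) * ‖φ (f (x k))‖ₑ) ≤ ENNReal.ofReal (4 * η) := by
    intro φ hφ
    refine ENNReal.summable.tsum_le_of_sum_le fun F => ?_
    rw [Finset.sum_ite, Finset.sum_const_zero, zero_add]
    refine le_trans (le_of_eq ?_) (ENNReal.ofReal_le_ofReal
      (htail φ hφ (F.filter (· ∉ F₀)) ?_))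
    · rw [ENNReal.ofReal_sum_of_nonneg fun _ _ => abs_nonneg _]
      refine Finset.sum_congr rfl fun k _ => ?_
      rw [abs_mul, abs_of_nonneg measureReal_nonneg, ENNReal.ofReal_mul measureReal_nonneg,
        ofReal_measureReal, ← Real.norm_eq_abs, ofReal_norm]
    · rw [Finset.disjoint_left]
      exact fun k hk => (Finset.mem_filter.1 hk).2
  let C : ℝ≥0∞ := ∑ k ∈ F₀, ‖f (x k)‖ₑ + 1
  have hC : C ≠ ∞ := by
    simp [C, ENNReal.sum_eq_top]
  have hC0 : C ≠ 0 := by simp [C]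
  refine ⟨ε / 2 / C, (ENNReal.div_pos (ENNReal.half_pos hε).ne' hC).ne', fun B hB hBδ φ hφ => ?_⟩
  have hle : ∀ y, ‖φ y‖ₑ ≤ ‖y‖ₑ := StrongDual.enorm_apply_le_of_norm_le_one hφ
  have hcov : B = ⋃ k, B ∩ U k := by rw [← inter_iUnion, hU.3, inter_univ]
  have hBmeas : ∀ k, MeasurableSet (B ∩ U k) := fun k => hB.inter (hU.1 k)
  have hBdisj : Pairwise (Function.onFun Disjoint fun k => B ∩ U k) := fun m n hmn =>
    (hU.2 m n hmn).mono inter_subset_right inter_subset_right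
  have hBsum : ν B = ∑' k, ν (B ∩ U k) := by
    conv_lhs => rw [hcov]
    exact measure_iUnion hBdisj hBmeas
  calc ∫⁻ y in B, ‖φ (f y)‖ₑ ∂ν
      = ∑' k, ∫⁻ y in B ∩ U k, ‖φ (f y)‖ₑ ∂ν := by
        conv_lhs => rw [hcov]
        exact lintegral_iUnion hBmeas hBdisj _
    _ ≤ ∑' k, (‖φ (f (x k))‖ₑ + 1) * ν (B ∩ U k) := by
        refine ENNReal.tsum_le_tsum fun k => ?_
        rw [← setLIntegral_const]
        refine setLIntegral_mono' (hBmeas k) fun y hy => ?_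
        have h1 : φ (f y) = φ (f (x k)) + φ (f y - f (x k)) := by simp
        rw [h1]
        refine (enorm_add_le _ _).trans (add_le_add le_rfl ((hle _).trans ?_))
        rw [← ofReal_norm, ← ENNReal.ofReal_one]
        exact ENNReal.ofReal_le_ofReal (hosc k y hy.2)
    _ ≤ ∑' k, (C * ν (B ∩ U k) + if k ∈ F₀ then 0 else ν (U k) * ‖φ (f (x k))‖ₑ) := by
        refine ENNReal.tsum_le_tsum fun k => ?_
        split_ifs with hk
        · rw [add_zero]
          refine mul_le_mul_left (add_le_add ((hle _).trans ?_) le_rfl) _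
          exact Finset.single_le_sum (f := fun k => ‖f (x k)‖ₑ) (fun _ _ => zero_le) hk
        · rw [add_mul, add_comm, mul_comm (ν (U k))]
          refine add_le_add (mul_le_mul_left ?_ _)
            (mul_le_mul_right (measure_mono inter_subset_right) _)
          exact le_add_self
    _ = C * ν B + ∑' k, (if k ∈ F₀ then 0 else ν (U k) * ‖φ (f (x k))‖ₑ) := by
        rw [ENNReal.tsum_add, ENNReal.tsum_mul_left, hBsum]
    _ ≤ ε / 2 + ε / 2 := by
        refine add_le_add ?_ ((htail' φ hφ).trans hηε)
        rw [mul_comm]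
        exact (ENNReal.le_div_iff_mul_le (Or.inl hC0) (Or.inl hC)).1 hBδ
    _ = ε := ENNReal.add_halves ε

/-- A strongly measurable function is bounded off a set of small measure, so uniform integrability
bounds the `L¹` norms of all `φ ∘ f`, even in the presence of atoms. -/
theorem DualUniformlyIntegrable.exists_lintegral_le {ν : Measure α} [IsFiniteMeasure ν] {f : α → X}
    (hf : StronglyMeasurable f) (h : DualUniformlyIntegrable ν f) :
    ∃ C : ℝ≥0∞, C ≠ ∞ ∧ ∀ φ : StrongDual ℝ X, ‖φ‖ ≤ 1 → ∫⁻ x, ‖φ (f x)‖ₑ ∂ν ≤ C := by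
  obtain ⟨δ, hδ, hδ'⟩ := h 1 one_ne_zero
  have hmeas : ∀ n : ℕ, MeasurableSet {x | (n : ℝ) < ‖f x‖} := fun n =>
    measurableSet_lt measurable_const hf.norm.measurable
  have hanti : Antitone fun n : ℕ => {x | (n : ℝ) < ‖f x‖} := fun m n hmn x hx =>
    lt_of_le_of_lt (Nat.cast_le.2 hmn : (m : ℝ) ≤ n) (show (n : ℝ) < ‖f x‖ from hx)
  have hempty : ⋂ n : ℕ, {x | (n : ℝ) < ‖f x‖} = ∅ := by
    refine eq_empty_of_forall_notMem fun x hx => ?_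
    obtain ⟨n, hn⟩ := exists_nat_ge ‖f x‖
    exact absurd (mem_iInter.1 hx n) (not_lt.2 hn)
  have hlim := tendsto_measure_iInter_atTop (μ := ν) (fun n => (hmeas n).nullMeasurableSet) hanti
    ⟨0, measure_ne_top ν _⟩
  rw [hempty, measure_empty] at hlim
  obtain ⟨n, hn⟩ := (hlim.eventually (Iic_mem_nhds (pos_iff_ne_zero.2 hδ))).exists
  refine ⟨1 + n * ν univ, by finiteness, fun φ hφ => ?_⟩
  rw [← lintegral_add_compl _ (hmeas n)]
  refine add_le_add (hδ' _ (hmeas n) hn φ hφ) ?_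
  refine (setLIntegral_mono' (g := fun _ => (n : ℝ≥0∞)) (hmeas n).compl fun x hx => ?_).trans ?_
  · have h1 : ‖φ (f x)‖ ≤ n :=
      (StrongDual.norm_apply_le_of_norm_le_one hφ _).trans (not_lt.1 hx)
    rw [← ofReal_norm, ← ENNReal.ofReal_natCast]
    exact ENNReal.ofReal_le_ofReal h1
  · rw [setLIntegral_const]
    exact mul_le_mul_right (measure_mono (subset_univ _)) _

theorem StrongDual.exists_eq_smul_of_norm_le_one (φ : StrongDual ℝ X) :
    ∃ ψ : StrongDual ℝ X, ‖ψ‖ ≤ 1 ∧ φ = ‖φ‖ • ψ := by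
  rcases eq_or_ne φ 0 with rfl | h
  · exact ⟨0, by simp, by simp⟩
  · refine ⟨‖φ‖⁻¹ • φ, ?_, ?_⟩
    · rw [norm_smul, norm_inv, norm_norm, inv_mul_cancel₀ (norm_ne_zero_iff.2 h)]
    · rw [smul_smul, mul_inv_cancel₀ (norm_ne_zero_iff.2 h), one_smul]

theorem MeasureTheory.StronglyMeasurable.dual_apply {f : α → X} (hf : StronglyMeasurable f)
    (φ : StrongDual ℝ X) : StronglyMeasurable fun x => φ (f x) :=
  φ.continuous.comp_stronglyMeasurable hf

theorem DualUniformlyIntegrable.integrable_dual_apply {ν : Measure α} [IsFiniteMeasure ν]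
    {f : α → X} (hf : StronglyMeasurable f) (h : DualUniformlyIntegrable ν f)
    (φ : StrongDual ℝ X) : Integrable (fun x => φ (f x)) ν := by
  obtain ⟨ψ, hψ, hφψ⟩ := StrongDual.exists_eq_smul_of_norm_le_one φ
  obtain ⟨C, hC, hC'⟩ := h.exists_lintegral_le hf
  have h1 : Integrable (fun x => ψ (f x)) ν :=
    ⟨(hf.dual_apply ψ).aestronglyMeasurable, (hC' ψ hψ).trans_lt hC.lt_top⟩
  rw [hφψ]
  exact h1.smul ‖φ‖

theorem DualUniformlyIntegrable.add {ν : Measure α} {f g : α → X}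
    (hf : StronglyMeasurable f) (h : DualUniformlyIntegrable ν f)
    (h' : DualUniformlyIntegrable ν g) :
    DualUniformlyIntegrable ν (fun x => f x + g x) := by
  intro ε hε
  obtain ⟨δ, hδ, hδ'⟩ := h (ε / 2) (ENNReal.half_pos hε).ne'
  obtain ⟨δ₂, hδ₂, hδ₂'⟩ := h' (ε / 2) (ENNReal.half_pos hε).ne'
  refine ⟨min δ δ₂, by simp [hδ, hδ₂], fun B hB hBδ φ hφ => ?_⟩
  calc ∫⁻ x in B, ‖φ (f x + g x)‖ₑ ∂ν ≤ ∫⁻ x in B, ‖φ (f x)‖ₑ + ‖φ (g x)‖ₑ ∂ν :=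
        lintegral_mono fun x => by rw [map_add]; exact enorm_add_le _ _
    _ = ∫⁻ x in B, ‖φ (f x)‖ₑ ∂ν + ∫⁻ x in B, ‖φ (g x)‖ₑ ∂ν :=
        lintegral_add_left (hf.dual_apply φ).enorm _
    _ ≤ ε / 2 + ε / 2 := add_le_add (hδ' B hB (hBδ.trans (min_le_left _ _)) φ hφ)
        (hδ₂' B hB (hBδ.trans (min_le_right _ _)) φ hφ)
    _ = ε := ENNReal.add_halves ε

theorem DualUniformlyIntegrable.neg {ν : Measure α} {f : α → X}
    (h : DualUniformlyIntegrable ν f) : DualUniformlyIntegrable ν (fun x => -f x) := by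
  simpa [DualUniformlyIntegrable] using h

theorem MeasureTheory.Integrable.dualUniformlyIntegrable {ν : Measure α} {f : α → X}
    (hf : Integrable f ν) : DualUniformlyIntegrable ν f := by
  intro ε hε
  obtain ⟨δ, hδ, hδ'⟩ := exists_pos_setLIntegral_lt_of_measure_lt hf.2.ne hε
  obtain ⟨δ₂, hδ₂, hδ₂δ⟩ := exists_between hδ
  exact ⟨δ₂, hδ₂.ne', fun B _ hBδ φ hφ =>
    (lintegral_mono fun x => StrongDual.enorm_apply_le_of_norm_le_one hφ (f x)).trans
      (hδ' B (hBδ.trans_lt hδ₂δ)).le⟩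

section RiemannSum

variable {ν : Measure α} [IsFiniteMeasure ν] {f : α → X} {A : Set α} {U : ℕ → Set α} {ε : ℝ}
  {x : ℕ → α}

theorem norm_measureReal_smul_sub_setIntegral_le {g : α → ℝ} (hg : Integrable g ν) {B : Set α}
    {c : ℝ} (h : ∀ y ∈ B, ‖c - g y‖ ≤ ε) :
    ‖ν.real B * c - ∫ y in B, g y ∂ν‖ ≤ ε * ν.real B := by
  have h1 : ν.real B * c - ∫ y in B, g y ∂ν = ∫ y in B, (c - g y) ∂ν := by
    rw [integral_sub (integrable_const c) hg.integrableOn, setIntegral_const, smul_eq_mul]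
  rw [h1]
  exact norm_setIntegral_le_of_norm_le_const (measure_lt_top ν B) h

theorem IsMeasurablePartition.hasSum_measureReal (hU : IsMeasurablePartition A U) :
    HasSum (fun n => ν.real (U n)) (ν.real A) := by
  have h : ν A = ∑' n, ν (U n) := by
    rw [← hU.3]; exact measure_iUnion (fun m n hmn => hU.2 m n hmn) hU.1
  have h2 : ∑' n, ν (U n) ≠ ∞ := h ▸ measure_ne_top ν A
  have := ENNReal.hasSum_toReal h2
  rwa [← ENNReal.tsum_toReal_eq fun n => measure_ne_top ν _, ← h] at this

/-- Every Riemann sum of `f` over a partition of small oscillation converges unconditionally, and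
its sum is a weak approximation of the integral. -/
theorem DualUniformlyIntegrable.exists_hasSum [CompleteSpace X] (hf : StronglyMeasurable f)
    (h : DualUniformlyIntegrable ν f) (hU : IsMeasurablePartition A U) (hε : 0 < ε)
    (hosc : ∀ n, ∀ y ∈ U n, ∀ z ∈ U n, ‖f y - f z‖ ≤ ε)
    (hx : ∀ n, (U n).Nonempty → x n ∈ U n) :
    ∃ S, HasSum (fun n => ν.real (U n) • f (x n)) S ∧
      ∀ φ : StrongDual ℝ X, ‖φ S - ∫ y in A, φ (f y) ∂ν‖ ≤ ε * ν.real A * ‖φ‖ := by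
  have hterm : ∀ (φ : StrongDual ℝ X) n,
      ‖ν.real (U n) * φ (f (x n)) - ∫ y in U n, φ (f y) ∂ν‖ ≤ ε * ‖φ‖ * ν.real (U n) := by
    intro φ n
    refine norm_measureReal_smul_sub_setIntegral_le (h.integrable_dual_apply hf φ) 
      fun y hy => ?_
    rw [← map_sub, mul_comm]
    exact (φ.le_opNorm _).trans
      (mul_le_mul_of_nonneg_left (hosc n _ (hx n ⟨y, hy⟩) y hy) (norm_nonneg _))
  have hsum : Summable fun n => ν.real (U n) • f (x n) := by
    rw [summable_iff_vanishing_norm]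
    intro η hη
    obtain ⟨δ, hδ, hδ'⟩ := h (ENNReal.ofReal (η / 2)) (by simpa using hη)
    obtain ⟨r, hr, hrδ⟩ : ∃ r : ℝ, 0 < r ∧ ENNReal.ofReal r ≤ δ := by
      obtain ⟨r, hr, hr'⟩ := ENNReal.lt_iff_exists_nnreal_btwn.1 (pos_iff_ne_zero.2 hδ)
      exact ⟨r, by exact_mod_cast hr, by rw [ENNReal.ofReal_coe_nnreal]; exact hr'.le⟩
    -- beyond `s`, both the union of the members and the error `ε` times its measure are small
    obtain ⟨s, hs⟩ := summable_iff_vanishing_norm.1 (hU.hasSum_measureReal (ν := ν)).summable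
      (min r (η / (2 * ε))) (lt_min hr (by positivity))
    refine ⟨s, fun t hts => ?_⟩
    have ht := hs t hts
    rw [Real.norm_of_nonneg (Finset.sum_nonneg fun _ _ => measureReal_nonneg)] at ht
    obtain ⟨φ, hφ, hφS⟩ := exists_dual_vector'' ℝ (∑ n ∈ t, ν.real (U n) • f (x n))
    have hBt : MeasurableSet (⋃ n ∈ t, U n) := t.measurableSet_biUnion fun n _ => hU.1 n
    have hdisj : (t : Set ℕ).PairwiseDisjoint U := fun m _ n _ hmn => hU.2 m n hmn
    have hνt : ν (⋃ n ∈ t, U n) ≤ δ := by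
      refine le_trans ?_ hrδ
      rw [measure_biUnion_finset hdisj fun n _ => hU.1 n]
      refine le_trans (le_of_eq ?_) (ENNReal.ofReal_le_ofReal (ht.trans_le (min_le_left _ _)).le)
      rw [ENNReal.ofReal_sum_of_nonneg fun _ _ => measureReal_nonneg]
      simp
    have h1 : ‖∫ y in ⋃ n ∈ t, U n, φ (f y) ∂ν‖ ≤ η / 2 := by
      have h2 := (enorm_integral_le_lintegral_enorm (μ := ν.restrict (⋃ n ∈ t, U n))
        (fun y => φ (f y))).trans (hδ' _ hBt hνt φ hφ)
      rw [← ofReal_norm] at h2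
      exact (ENNReal.ofReal_le_ofReal_iff (half_pos hη).le).1 h2
    have h2 : ‖∑ n ∈ t, ν.real (U n) • f (x n)‖ =
        ∑ n ∈ t, (ν.real (U n) * φ (f (x n)) - ∫ y in U n, φ (f y) ∂ν) +
          ∫ y in ⋃ n ∈ t, U n, φ (f y) ∂ν := by
      rw [integral_biUnion_finset t (fun n _ => hU.1 n) hdisj fun n _ =>
        (h.integrable_dual_apply hf φ).integrableOn, ← Finset.sum_add_distrib]
      simp only [sub_add_cancel]
      have h3 : φ (∑ n ∈ t, ν.real (U n) • f (x n)) = ∑ n ∈ t, ν.real (U n) * φ (f (x n)) := by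
        simp
      rw [← h3, hφS]
      rfl
    have h3 : ∑ n ∈ t, (ν.real (U n) * φ (f (x n)) - ∫ y in U n, φ (f y) ∂ν) ≤
        ε * ∑ n ∈ t, ν.real (U n) := by
      rw [Finset.mul_sum]
      refine Finset.sum_le_sum fun n _ => (le_abs_self _).trans ((hterm φ n).trans ?_)
      refine mul_le_mul_of_nonneg_right ?_ measureReal_nonneg
      exact mul_le_of_le_one_right hε.le hφ
    have h4 : ε * ∑ n ∈ t, ν.real (U n) < η / 2 := by
      have h5 := mul_lt_mul_of_pos_left (ht.trans_le (min_le_right _ _)) hε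
      have h6 : ε * (η / (2 * ε)) = η / 2 := by field_simp
      rwa [h6] at h5
    rw [h2]
    linarith [(le_abs_self _).trans h1]
  obtain ⟨S, hS⟩ := hsum
  refine ⟨S, hS, fun φ => ?_⟩
  have h1 : HasSum (fun n => ν.real (U n) * φ (f (x n))) (φ S) := by
    simpa using φ.hasSum hS
  have h2 : HasSum (fun n => ∫ y in U n, φ (f y) ∂ν) (∫ y in A, φ (f y) ∂ν) := by
    rw [← hU.3]
    exact hasSum_integral_iUnion hU.1 (fun m n hmn => hU.2 m n hmn)
      (h.integrable_dual_apply hf φ).integrableOn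
  have h3 := tsum_of_norm_bounded ((hU.hasSum_measureReal (ν := ν)).mul_left (ε * ‖φ‖)) (hterm φ)
  rw [(h1.sub h2).tsum_eq] at h3
  exact h3.trans_eq (by ring)

end RiemannSum

/-- The converse of `BirkhoffIntegrable.dualUniformlyIntegrable`, over every measurable set,
together with the fact that the Birkhoff integral is then the Pettis integral. -/
theorem DualUniformlyIntegrable.exists_hasBirkhoffIntegral [CompleteSpace X] [Nonempty α]
    {ν : Measure α} [IsFiniteMeasure ν] {f : α → X} (hf : StronglyMeasurable f)
    (h : DualUniformlyIntegrable ν f) {A : Set α} (hA : MeasurableSet A) :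
    ∃ J, HasBirkhoffIntegral ν f A J ∧
      ∀ φ : StrongDual ℝ X, φ J = ∫ y in A, φ (f y) ∂ν := by
  -- `J` is the limit of Riemann sums `S n` over partitions with oscillation at most `1 / (n + 1)`
  have hpos : ∀ n : ℕ, 0 < 1 / ((n : ℝ) + 1) := fun n => Nat.one_div_pos_of_nat
  choose W hW hWosc using fun n : ℕ => hf.exists_partition_norm_sub_le hA (hpos n)
  choose x hx using fun n => exists_mem_of_nonempty (W n)
  choose S hS hSφ using fun n => h.exists_hasSum hf (hW n) (hpos n) (hWosc n) (hx n)
  have h0 : Tendsto (fun n : ℕ => 1 / ((n : ℝ) + 1) * ν.real A) atTop (𝓝 0) := by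
    simpa using tendsto_one_div_add_atTop_nhds_zero_nat.mul_const (ν.real A)
  have hcauchy : CauchySeq S := by
    refine cauchySeq_of_le_tendsto_0 (fun n : ℕ => 2 * (1 / ((n : ℝ) + 1) * ν.real A))
      (fun n m N hn hm => ?_) (by simpa using h0.const_mul 2)
    rw [dist_eq_norm]
    refine NormedSpace.norm_le_dual_bound ℝ _ (by have := hpos N; positivity) fun φ => ?_
    have hle : ∀ k : ℕ, N ≤ k → 1 / ((k : ℝ) + 1) * ν.real A * ‖φ‖ ≤
        1 / ((N : ℝ) + 1) * ν.real A * ‖φ‖ := fun k hk => by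
      gcongr
    have h1 := norm_sub_le (φ (S n) - ∫ y in A, φ (f y) ∂ν) (φ (S m) - ∫ y in A, φ (f y) ∂ν)
    rw [sub_sub_sub_cancel_right, ← map_sub] at h1
    linarith [hSφ n φ, hSφ m φ, hle n hn, hle m hm]
  obtain ⟨J, hJ⟩ := cauchySeq_tendsto_of_complete hcauchy
  have hJφ : ∀ φ : StrongDual ℝ X, φ J = ∫ y in A, φ (f y) ∂ν := fun φ => by
    refine tendsto_nhds_unique ((φ.continuous.tendsto J).comp hJ) ?_
    rw [tendsto_iff_norm_sub_tendsto_zero]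
    refine squeeze_zero (fun _ => norm_nonneg _) (fun n => hSφ n φ) ?_
    simpa using h0.mul_const ‖φ‖
  refine ⟨J, fun ε hε => ?_, hJφ⟩
  -- an oscillation that leaves an error of at most `ε / 2` on all of `A`
  have hη : 0 < ε / (2 * (ν.real A + 1)) := by positivity
  obtain ⟨V, hV, hVosc⟩ := hf.exists_partition_norm_sub_le hA hη
  refine ⟨V, hV, fun U hU hUV y hy => ?_⟩
  have hUosc : ∀ n, ∀ a ∈ U n, ∀ b ∈ U n, ‖f a - f b‖ ≤ ε / (2 * (ν.real A + 1)) :=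
    fun n a ha b hb => by
      obtain ⟨m, hm⟩ := hUV n
      exact hVosc m a (hm ha) b (hm hb)
  obtain ⟨R, hR, hRφ⟩ := h.exists_hasSum hf hU hη hUosc hy
  have hRJ : ‖R - J‖ ≤ ε / (2 * (ν.real A + 1)) * ν.real A := by
    refine NormedSpace.norm_le_dual_bound ℝ _ (by positivity) fun φ => ?_
    rw [map_sub, hJφ]
    exact hRφ φ
  have hlim : Tendsto (fun n : ℕ => ‖(∑ k ∈ Finset.range n, ν.real (U k) • f (y k)) - J‖ₑ) atTop
      (𝓝 ‖R - J‖ₑ) := (hR.tendsto_sum_nat.sub_const J).enorm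
  rw [hlim.limsup_eq, ← ofReal_norm, ENNReal.ofReal_lt_ofReal_iff hε]
  refine hRJ.trans_lt ?_
  rw [div_mul_eq_mul_div, div_lt_iff₀ (by positivity)]
  nlinarith [measureReal_nonneg (μ := ν) (s := A)]

end BirkhoffTheory

/-! ### Strong measurability -/

section PettisMeasurability

variable {α X : Type*} {m : MeasurableSpace α} [NormedAddCommGroup X] [NormedSpace ℝ X]

/-- On a separable range, the distance to `a` is a supremum of countably many functionals. -/
theorem measurableSet_norm_sub_le_of_dual_apply {f : α → X}
    (hf : ∀ φ : StrongDual ℝ X, Measurable fun x => φ (f x)) {c : Set X} (hc : c.Countable)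
    (hfc : range f ⊆ closure c) (a : X) (r : ℝ) : MeasurableSet {x | ‖f x - a‖ ≤ r} := by
  -- for `x` in `closure c`, the norm of `x - a` is the supremum of `ψ d (x - a)` over `d ∈ c`
  choose ψ hψ hψa using fun d : X => exists_dual_vector'' ℝ (d - a)
  have h : {x | ‖f x - a‖ ≤ r} = ⋂ d ∈ c, {x | ψ d (f x) - ψ d a ≤ r} := by
    ext x
    simp only [mem_ofPred_eq, mem_iInter, ← map_sub]
    refine ⟨fun hx d _ => (le_abs_self _).trans
      ((StrongDual.norm_apply_le_of_norm_le_one (hψ d) _).trans hx), fun hx => ?_⟩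
    refine le_of_forall_pos_le_add fun ε hε => ?_
    obtain ⟨d, hd, hxd⟩ := Metric.mem_closure_iff.1 (hfc (mem_range_self x)) (ε / 2) (half_pos hε)
    rw [dist_eq_norm] at hxd
    have h1 : ‖f x - a‖ ≤ ‖f x - d‖ + ‖d - a‖ := by
      simpa using norm_add_le (f x - d) (d - a)
    have h2 : ‖d - a‖ = ψ d (f x - a) - ψ d (f x - d) := by
      rw [← map_sub, sub_sub_sub_cancel_left]
      exact (hψa d).symm
    have h3 := (neg_le_abs _).trans (StrongDual.norm_apply_le_of_norm_le_one (hψ d) (f x - d))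
    linarith [hx d hd]
  rw [h]
  exact MeasurableSet.biInter hc fun d _ =>
    measurableSet_le ((hf (ψ d)).sub measurable_const) measurable_const

/-- The **Pettis measurability theorem**: a weakly measurable function with separable range is
strongly measurable. -/
theorem stronglyMeasurable_of_dual_apply {f : α → X}
    (hsep : TopologicalSpace.IsSeparable (range f))
    (hf : ∀ φ : StrongDual ℝ X, Measurable fun x => φ (f x)) : StronglyMeasurable f := by
  borelize X
  refine stronglyMeasurable_iff_measurable_separable.2 ⟨measurable_of_isOpen fun O hO => ?_, hsep⟩
  obtain ⟨c, hc, hfc⟩ := hsep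
  have h : f ⁻¹' O = ⋃ a ∈ c, ⋃ q : ℚ, ⋃ _ : Metric.closedBall a (q : ℝ) ⊆ O,
      {x | ‖f x - a‖ ≤ q} := by
    ext x
    simp only [mem_preimage, mem_iUnion, mem_ofPred_eq, exists_prop]
    constructor
    · intro hx
      obtain ⟨ε, hε, hεO⟩ := Metric.isOpen_iff.1 hO _ hx
      obtain ⟨q, hq, hqε⟩ := exists_rat_btwn (half_pos hε)
      obtain ⟨a, ha, hxa⟩ := Metric.mem_closure_iff.1 (hfc (mem_range_self x)) q hq
      refine ⟨a, ha, q, fun y hy => hεO ?_, by rw [← dist_eq_norm]; exact hxa.le⟩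
      rw [Metric.mem_closedBall] at hy
      rw [Metric.mem_ball]
      have := dist_triangle y a (f x)
      rw [dist_comm a] at this
      linarith
    · rintro ⟨a, -, q, hq, hx⟩
      exact hq (by rwa [Metric.mem_closedBall, dist_eq_norm])
  rw [h]
  exact MeasurableSet.biUnion hc fun a _ => MeasurableSet.iUnion fun q => MeasurableSet.iUnion
    fun _ => measurableSet_norm_sub_le_of_dual_apply hf hc hfc a q

theorem HasBirkhoffIntegral.mem_closure_span [Nonempty α] {ν : Measure α} [IsFiniteMeasure ν]
    {f : α → X} {A : Set α} {J : X} (hJ : HasBirkhoffIntegral ν f A J) :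
    J ∈ closure (Submodule.span ℝ (range f) : Set X) := by
  refine Metric.mem_closure_iff.2 fun ε hε => ?_
  obtain ⟨V, hV, hV'⟩ := hJ ε hε
  obtain ⟨x, hx⟩ := exists_mem_of_nonempty V
  obtain ⟨n, hn⟩ := (eventually_lt_of_limsup_lt (hV' V hV (fun n => ⟨n, subset_rfl⟩) x hx)).exists
  rw [← ofReal_norm, ENNReal.ofReal_lt_ofReal_iff hε] at hn
  refine ⟨∑ k ∈ Finset.range n, ν.real (V k) • f (x k), Submodule.sum_mem _ fun k _ =>
    Submodule.smul_mem _ _ (Submodule.subset_span (mem_range_self (x k))), ?_⟩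
  rwa [dist_comm, dist_eq_norm]

end PettisMeasurability

/-- The derivative is a pointwise limit of difference quotients. -/
theorem stronglyMeasurable_derivWithin_Icc {X : Type*} [NormedAddCommGroup X] [NormedSpace ℝ X]
    {T : ℝ} (hT : 0 < T) {Φ : ℝ → X} (hΦ : StronglyMeasurable fun t : Icc (0 : ℝ) T => Φ t)
    (hd : DifferentiableOn ℝ Φ (Icc 0 T)) :
    StronglyMeasurable fun r : Icc (0 : ℝ) T => derivWithin Φ (Icc 0 T) r := by
  let c : ℕ → ℝ := fun n => T / 2 * (1 / ((n : ℝ) + 1))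
  have hc0 : ∀ n, 0 < c n := fun n => mul_pos (half_pos hT) Nat.one_div_pos_of_nat
  have hcT : ∀ n, c n ≤ T / 2 := fun n =>
    mul_le_of_le_one_right (half_pos hT).le (by
      rw [div_le_one (by positivity)]; linarith [Nat.cast_nonneg (α := ℝ) n])
  have hclim : Tendsto c atTop (𝓝 0) := by
    simpa only [mul_zero] using tendsto_one_div_add_atTop_nhds_zero_nat.const_mul (T / 2)
  -- steps are taken towards the middle of the interval, so as to stay inside it
  let s : Icc (0 : ℝ) T → ℝ := fun r => if (r : ℝ) ≤ T / 2 then 1 else -1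
  have hs : Measurable s := Measurable.ite
    (measurableSet_le measurable_subtype_coe measurable_const) measurable_const measurable_const
  have hs' : ∀ r, s r = 1 ∨ s r = -1 := fun r => by
    simp only [s]; split_ifs <;> simp
  have hmem : ∀ n (r : Icc (0 : ℝ) T), (r : ℝ) + s r * c n ∈ Icc (0 : ℝ) T := fun n r => by
    have h1 := r.2.1
    have h2 := r.2.2
    have h3 := hc0 n
    have h4 := hcT n
    simp only [s]
    split_ifs <;> constructor <;> linarith
  have hne : ∀ n r, s r * c n ≠ 0 := fun n r => by
    rcases hs' r with h | h <;> simp [h, (hc0 n).ne']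
  refine stronglyMeasurable_of_tendsto (u := atTop)
    (f := fun n (r : Icc (0 : ℝ) T) => slope Φ r (r + s r * c n)) (fun n => ?_) ?_
  · simp only [slope_def_module]
    have h1 : Measurable fun r : Icc (0 : ℝ) T => (r : ℝ) + s r * c n - r :=
      (measurable_subtype_coe.add (hs.mul_const _)).sub measurable_subtype_coe
    have h2 : Measurable fun r : Icc (0 : ℝ) T =>
        (⟨(r : ℝ) + s r * c n, hmem n r⟩ : Icc (0 : ℝ) T) :=
      (measurable_subtype_coe.add (hs.mul_const _)).subtype_mk
    exact h1.inv.stronglyMeasurable.smul ((hΦ.comp_measurable h2).sub hΦ)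
  · rw [tendsto_pi_nhds]
    intro r
    have h1 := hasDerivWithinAt_iff_tendsto_slope.1 (hd r r.2).hasDerivWithinAt
    refine h1.comp (tendsto_nhdsWithin_iff.2 ⟨?_, Eventually.of_forall fun n => ⟨hmem n r, ?_⟩⟩)
    · simpa using (hclim.const_mul (s r)).const_add (r : ℝ)
    · simpa using hne n r

/-! ### Gaussian moments -/

section Gaussian

variable {Ω : Type*} {mΩ : MeasurableSpace Ω} {P : Measure Ω}

theorem gaussianReal_zero_eq_map (v : ℝ≥0) :
    gaussianReal 0 v = (gaussianReal 0 1).map (fun x => √(v : ℝ) * x) := by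
  rw [gaussianReal_map_const_mul]
  congr 1
  · simp
  · ext; simp

theorem ProbabilityTheory.HasLaw.lintegral_enorm_gaussianReal {Y : Ω → ℝ} {v : ℝ≥0}
    (hY : HasLaw Y (gaussianReal 0 v) P) :
    ∫⁻ ω, ‖Y ω‖ₑ ∂P = ‖√(v : ℝ)‖ₑ * ∫⁻ x, ‖x‖ₑ ∂(gaussianReal 0 1) := by
  rw [hY.lintegral_comp (f := fun x => ‖x‖ₑ) (by fun_prop), gaussianReal_zero_eq_map,
    lintegral_map (by fun_prop) (by fun_prop)]
  simp only [enorm_mul]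
  rw [lintegral_const_mul _ (by fun_prop)]

theorem ProbabilityTheory.HasLaw.eLpNorm_two_gaussianReal {Y : Ω → ℝ} {v : ℝ≥0}
    (hY : HasLaw Y (gaussianReal 0 v) P) :
    eLpNorm Y 2 P = ‖√(v : ℝ)‖ₑ * eLpNorm id 2 (gaussianReal 0 1) := by
  have h1 : eLpNorm Y 2 P = eLpNorm id 2 (gaussianReal 0 v) := by
    rw [← hY.map_eq, eLpNorm_map_measure aestronglyMeasurable_id hY.aemeasurable]
    rfl
  rw [h1, gaussianReal_zero_eq_map, eLpNorm_map_measure aestronglyMeasurable_id (by fun_prop),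
    ← eLpNorm_const_smul]
  rfl

theorem lintegral_enorm_gaussianReal_ne_zero : ∫⁻ x, ‖x‖ₑ ∂(gaussianReal 0 1) ≠ 0 := by
  rw [Ne, lintegral_eq_zero_iff (by fun_prop)]
  intro h
  have : NullSingletonClass (gaussianReal 0 1) := nullSingletonClass_gaussianReal one_ne_zero
  have h1 : ∀ᵐ x ∂(gaussianReal 0 1), x ≠ 0 := by
    rw [ae_iff]
    simp
  obtain ⟨x, hx, hx'⟩ := (h.and h1).exists
  simp at hx
  exact hx' hx

theorem lintegral_enorm_gaussianReal_ne_top : ∫⁻ x, ‖x‖ₑ ∂(gaussianReal 0 1) ≠ ∞ := by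
  have h := (memLp_id_gaussianReal (μ := 0) (v := 1) 1).eLpNorm_ne_top
  simpa [eLpNorm_one_eq_lintegral_enorm] using h

end Gaussian

/-! ### Brownian motion: size, martingale property, measurability -/

section Brownian

variable {Ω : Type*} {mΩ : MeasurableSpace Ω} {P : Measure Ω} {T : ℝ}
  {w : Icc (0 : ℝ) T → Ω → ℝ}

namespace IsBrownianMotion

theorem hasLaw_eval (hw : IsBrownianMotion w P) (r : Icc (0 : ℝ) T) :
    HasLaw (w r) (gaussianReal 0 (Real.toNNReal r)) P := by
  have h0 : (0 : ℝ) ∈ Icc (0 : ℝ) T := ⟨le_rfl, r.2.1.trans r.2.2⟩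
  have h := hw.law_increment ⟨0, h0⟩ r r.2.1
  rw [sub_zero] at h
  refine h.congr ?_
  filter_upwards [hw.start ⟨0, h0⟩ rfl] with ω hω
  rw [hω, sub_zero]

theorem lintegral_enorm_eq (hw : IsBrownianMotion w P) (r : Icc (0 : ℝ) T) :
    ∫⁻ ω, ‖w r ω‖ₑ ∂P = ‖√(r : ℝ)‖ₑ * ∫⁻ x, ‖x‖ₑ ∂(gaussianReal 0 1) := by
  rw [(hw.hasLaw_eval r).lintegral_enorm_gaussianReal, Real.coe_toNNReal _ r.2.1]

/-- By the Cauchy–Schwarz inequality, small events carry a small part of `E |w r|`, uniformly on the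
scale `√r`. -/
theorem setLIntegral_enorm_le (hw : IsBrownianMotion w P) (r : Icc (0 : ℝ) T) (B : Set Ω) :
    ∫⁻ ω in B, ‖w r ω‖ₑ ∂P ≤
      ‖√(r : ℝ)‖ₑ * (eLpNorm id 2 (gaussianReal 0 1) * P B ^ (1 / 2 : ℝ)) := by
  have h := eLpNorm_le_eLpNorm_mul_rpow_measure_univ (μ := P.restrict B) (f := w r)
    (p := 1) (q := 2) (by norm_num) (hw.measurable r).aestronglyMeasurable
  rw [eLpNorm_one_eq_lintegral_enorm, Measure.restrict_apply_univ] at h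
  have h2 : (1 / (1 : ℝ≥0∞).toReal - 1 / (2 : ℝ≥0∞).toReal) = (1 / 2 : ℝ) := by norm_num
  rw [h2] at h
  refine h.trans ?_
  rw [← mul_assoc]
  refine mul_le_mul_left ((eLpNorm_mono_measure _ Measure.restrict_le_self).trans_eq ?_) _
  rw [(hw.hasLaw_eval r).eLpNorm_two_gaussianReal, Real.coe_toNNReal _ r.2.1]

theorem memLp_two (hw : IsBrownianMotion w P) (r : Icc (0 : ℝ) T) : MemLp (w r) 2 P :=
  (hw.hasLaw_eval r).hasGaussianLaw.memLp_two

theorem isGaussianProcess (hw : IsBrownianMotion w P) (hT : 0 ≤ T) : IsGaussianProcess w P := by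
  let _ : OrderBot (Icc (0 : ℝ) T) := { bot := ⟨0, le_rfl, hT⟩, bot_le := fun r => r.2.1 }
  exact hw.indepIncrements.isGaussianProcess (fun t => (hw.hasLaw_eval t).hasGaussianLaw)
    (hw.start _ rfl)

/-- `w` is a Gaussian process, so it suffices that the increment is uncorrelated with the past. -/
theorem indepFun_past_increment (hw : IsBrownianMotion w P) {s t : Icc (0 : ℝ) T}
    (hst : s ≤ t) :
    IndepFun (fun ω (q : Iic s) => w q ω) (fun ω => w t ω - w s ω) P := by
  have hT : 0 ≤ T := s.2.1.trans s.2.2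
  have hG : IsGaussianProcess (Sum.elim (fun (q : Iic s) ω => w q ω)
      (fun (_ : Unit) ω => w t ω - w s ω)) P := by
    refine IsGaussianProcess.of_isGaussianProcess (hw.isGaussianProcess hT) fun i => ?_
    rcases i with q | _
    · exact ⟨{q.1}, ContinuousLinearMap.proj ⟨q.1, by simp⟩, fun ω => rfl⟩
    · exact ⟨{s, t}, ContinuousLinearMap.proj ⟨t, by simp⟩ - ContinuousLinearMap.proj ⟨s, by simp⟩,
        fun ω => rfl⟩
  have := hG.indepFun_of_covariance_eq_zero (fun q => (hw.measurable q).aemeasurable)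
    (fun _ => ((hw.measurable t).sub (hw.measurable s)).aemeasurable) fun q _ => ?_
  · exact this.comp measurable_id (measurable_pi_apply ())
  · refine IndepFun.covariance_eq_zero ?_ (hw.memLp_two q) ((hw.memLp_two t).sub (hw.memLp_two s))
    -- `w q` is almost surely the increment from `0` to `q`, and `0 ≤ q ≤ s ≤ t`
    let τ : ℕ → Icc (0 : ℝ) T
      | 0 => ⟨0, le_rfl, hT⟩
      | 1 => q
      | 2 => s
      | _ => t
    have hτ : Monotone τ := by
      refine monotone_nat_of_le_succ fun n => ?_
      match n with
      | 0 => exact q.1.2.1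
      | 1 => exact q.2
      | 2 => exact hst
      | n + 3 => exact le_rfl
    refine ((hw.indepIncrements.nat hτ).indepFun (show 0 ≠ 2 by decide)).congr ?_ .rfl
    filter_upwards [hw.start ⟨0, le_rfl, hT⟩ rfl] with ω hω
    simp [τ, hω]

/-- The martingale property of Brownian motion. -/
theorem setIntegral_eq [IsProbabilityMeasure P] (hw : IsBrownianMotion w P) {s t : Icc (0 : ℝ) T}
    (hst : s ≤ t) {E : Set Ω} (hE : MeasurableSet[hw.naturalFiltration s] E) :
    ∫ ω in E, w t ω ∂P = ∫ ω in E, w s ω ∂P := by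
  have hle := hw.naturalFiltration.le s
  have hint : Integrable (fun ω => w t ω - w s ω) P :=
    ((hw.memLp_two t).sub (hw.memLp_two s)).integrable one_le_two
  have hind : Indep (MeasurableSpace.comap (fun ω => w t ω - w s ω) inferInstance)
      (hw.naturalFiltration s) P := by
    have h := (hw.indepFun_past_increment hst).symm
    rw [IndepFun_iff_Indep] at h
    convert h using 1
    exact Filtration.natural_eq_comap _ _ _
  have h1 := condExp_indep_eq ((hw.measurable t).sub (hw.measurable s)).comap_le hle
    (f := fun ω => w t ω - w s ω)
    (comap_measurable _).stronglyMeasurable hind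
  have h2 : ∫ ω in E, (w t ω - w s ω) ∂P = 0 := by
    rw [← setIntegral_condExp hle hint hE, integral_congr_ae (ae_restrict_of_ae h1)]
    rw [(hw.law_increment s t hst).integral_eq, integral_id_gaussianReal]
    simp
  rw [integral_sub ((hw.memLp_two t).integrable one_le_two).integrableOn
    ((hw.memLp_two s).integrable one_le_two).integrableOn] at h2
  exact sub_eq_zero.1 h2

theorem measurable_uncurry (hw : IsBrownianMotion w P) :
    Measurable (Function.uncurry w) :=
  measurable_uncurry_of_continuous_of_measurable hw.continuous_paths hw.measurable

/-- The stopped process `w (min r t)` depends, jointly measurably, on the path up to time `t`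
only. -/
theorem measurable_uncurry_stopped (hw : IsBrownianMotion w P) (t : Icc (0 : ℝ) T) :
    Measurable[Prod.instMeasurableSpace (m₂ := hw.naturalFiltration t)]
      (fun p : Icc (0 : ℝ) T × Ω => w (min p.1 t) p.2) := by
  refine measurable_uncurry_of_continuous_of_measurable (m := hw.naturalFiltration t)
    (u := fun r ω => w (min r t) ω)
    (fun ω => (hw.continuous_paths ω).comp (continuous_id.min continuous_const)) fun r => ?_
  have h1 : MeasurableSpace.comap (w (min r t)) inferInstance ≤ hw.naturalFiltration t :=
    le_iSup₂_of_le (f := fun j _ => MeasurableSpace.comap (w j) _) (min r t) (min_le_right r t)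
      le_rfl
  exact (comap_measurable (w (min r t))).mono h1 le_rfl

end IsBrownianMotion

end Brownian

/-! ### Functions weighted by Brownian paths -/

section WeightedPaths

variable {Ω X : Type*} {mΩ : MeasurableSpace Ω} [NormedAddCommGroup X] [NormedSpace ℝ X]
  {P : Measure Ω} {T : ℝ} {w : Icc (0 : ℝ) T → Ω → ℝ}
  {D : Icc (0 : ℝ) T → X}

theorem stronglyMeasurable_sqrt_smul (hD : StronglyMeasurable D) :
    StronglyMeasurable fun r : Icc (0 : ℝ) T => √(r : ℝ) • D r :=
  (Real.continuous_sqrt.measurable.comp measurable_subtype_coe).stronglyMeasurable.smul hD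

namespace IsBrownianMotion

theorem stronglyMeasurable_mul_dual_apply (hw : IsBrownianMotion w P) (hD : StronglyMeasurable D)
    (φ : StrongDual ℝ X) :
    StronglyMeasurable fun p : Ω × Icc (0 : ℝ) T => w p.2 p.1 * φ (D p.2) :=
  (hw.measurable_uncurry.comp measurable_swap).stronglyMeasurable.mul
    ((hD.dual_apply φ).comp_measurable measurable_snd)

theorem lintegral_lintegral_enorm [IsProbabilityMeasure P] (hw : IsBrownianMotion w P)
    (hD : StronglyMeasurable D)
    (φ : StrongDual ℝ X) (E : Set Ω) (B : Set (Icc (0 : ℝ) T)) :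
    ∫⁻ ω in E, ∫⁻ r in B, ‖w r ω * φ (D r)‖ₑ ∂(lebesgueOn T) ∂P =
      ∫⁻ r in B, (∫⁻ ω in E, ‖w r ω‖ₑ ∂P) * ‖φ (D r)‖ₑ ∂(lebesgueOn T) := by
  rw [lintegral_lintegral_swap (hw.stronglyMeasurable_mul_dual_apply hD φ).enorm.aemeasurable]
  refine lintegral_congr fun r => ?_
  simp only [enorm_mul]
  exact lintegral_mul_const _ (hw.measurable r).enorm

/-- The bound by `√r • D r` that makes the path-weighted functions integrable on `Ω × [0, T]`. -/
theorem lintegral_lintegral_enorm_le [IsProbabilityMeasure P] (hw : IsBrownianMotion w P)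
    (hD : StronglyMeasurable D)
    (φ : StrongDual ℝ X) (E : Set Ω) (B : Set (Icc (0 : ℝ) T)) :
    ∫⁻ ω in E, ∫⁻ r in B, ‖w r ω * φ (D r)‖ₑ ∂(lebesgueOn T) ∂P ≤
      eLpNorm id 2 (gaussianReal 0 1) * P E ^ (1 / 2 : ℝ) *
        ∫⁻ r, ‖φ (√(r : ℝ) • D r)‖ₑ ∂(lebesgueOn T) := by
  have hmeas := stronglyMeasurable_sqrt_smul hD
  rw [hw.lintegral_lintegral_enorm hD, ← lintegral_const_mul _ (hmeas.dual_apply φ).enorm]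
  refine (lintegral_mono fun r => ?_).trans (setLIntegral_le_lintegral _ _)
  simp only [map_smul, smul_eq_mul, enorm_mul]
  refine (mul_le_mul_left (hw.setLIntegral_enorm_le r E) _).trans_eq ?_
  ring

/-- If the path-weighted functions `r ↦ w r ω • D r` are Birkhoff integrable for every path, then
the random weight may be replaced by its size `√r`. On an event `G` of probability close to `1`
the expectation of `|w r|` over `G` is at least a fixed multiple of `√r`, for all `r` at once. If
uniform integrability failed for `√r • D r` along sets `B n` and functionals `φ n`, the integrals
of `|w r ω| * |φ n (D r)|` over `B n` would still tend to `0` for every `ω`, hence in probability;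
averaging them over the event that they are small gives a contradiction. -/
theorem dualUniformlyIntegrable_sqrt_smul [IsProbabilityMeasure P] (hw : IsBrownianMotion w P)
    (hD : StronglyMeasurable D)
    (h : ∀ ω, DualUniformlyIntegrable (lebesgueOn T) fun r => w r ω • D r) :
    DualUniformlyIntegrable (lebesgueOn T) fun r => √(r : ℝ) • D r := by
  by_contra hcon
  simp only [DualUniformlyIntegrable, not_forall, not_exists, not_and, not_le] at hcon
  obtain ⟨ε, hε, hcon⟩ := hcon
  choose B hB hBδ φ hφ hBφ using fun n : ℕ =>
    hcon ((n : ℝ≥0∞)⁻¹) (ENNReal.inv_ne_zero.2 (ENNReal.natCast_ne_top n))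
  let Y : ℕ → Ω → ℝ≥0∞ := fun n ω => ∫⁻ r in B n, ‖w r ω * φ n (D r)‖ₑ ∂(lebesgueOn T)
  have hYmeas : ∀ n, Measurable (Y n) := fun n =>
    (hw.stronglyMeasurable_mul_dual_apply hD (φ n)).enorm.lintegral_prod_right'
  have hYlim : ∀ ω, ∀ η : ℝ≥0∞, η ≠ 0 → ∀ᶠ n in atTop, Y n ω ≤ η := fun ω η hη => by
    obtain ⟨δ, hδ, hδ'⟩ := h ω η hη
    filter_upwards [ENNReal.tendsto_inv_nat_nhds_zero.eventually
      (Iic_mem_nhds (pos_iff_ne_zero.2 hδ))] with n hn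
    simpa [Y, enorm_mul] using hδ' (B n) (hB n) ((hBδ n).trans hn) (φ n) (hφ n)
  set c := ∫⁻ x, ‖x‖ₑ ∂(gaussianReal 0 1) with hc
  have hc0 : c / 2 ≠ 0 := (ENNReal.half_pos lintegral_enorm_gaussianReal_ne_zero).ne'
  have hctop : c / 2 ≠ ∞ := ENNReal.div_ne_top lintegral_enorm_gaussianReal_ne_top two_ne_zero
  set C := eLpNorm id 2 (gaussianReal 0 1) with hC
  have hCtop : C ≠ ∞ := (memLp_id_gaussianReal (μ := 0) (v := 1) 2).eLpNorm_ne_top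
  let G : ℕ → Set Ω := fun n => {ω | Y n ω ≤ c / 2 * ε}
  have hG : ∀ n, MeasurableSet (G n) := fun n => hYmeas n measurableSet_Iic
  have hGlim : Tendsto (fun n => P (G n)ᶜ) atTop (𝓝 (P ∅)) := by
    refine tendsto_measure_of_ae_tendsto_indicator_of_isFiniteMeasure atTop MeasurableSet.empty
      (fun n => (hG n).compl) (Eventually.of_forall fun ω => ?_)
    filter_upwards [hYlim ω (c / 2 * ε) (mul_ne_zero hc0 hε)] with n hn
    simpa [G] using hn
  have hGlim' : Tendsto (fun n => C * P (G n)ᶜ ^ (1 / 2 : ℝ)) atTop (𝓝 0) := by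
    have h1 := ENNReal.Tendsto.const_mul (a := C)
      (((ENNReal.continuous_rpow_const (y := (1 / 2 : ℝ))).tendsto _).comp hGlim) (Or.inr hCtop)
    simpa using h1
  obtain ⟨n, hn⟩ := (hGlim'.eventually (Iic_mem_nhds (pos_iff_ne_zero.2 hc0))).exists
  -- the part of `E |w r|` on the complement of `G n` is at most half of the whole
  have hlower : ∀ r : Icc (0 : ℝ) T, ‖√(r : ℝ)‖ₑ * (c / 2) ≤ ∫⁻ ω in G n, ‖w r ω‖ₑ ∂P := by
    intro r
    have h1 : ‖√(r : ℝ)‖ₑ * (c / 2) + ‖√(r : ℝ)‖ₑ * (c / 2) =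
        ∫⁻ ω in G n, ‖w r ω‖ₑ ∂P + ∫⁻ ω in (G n)ᶜ, ‖w r ω‖ₑ ∂P := by
      rw [lintegral_add_compl _ (hG n), hw.lintegral_enorm_eq, ← mul_add, ENNReal.add_halves]
    have h2 : ∫⁻ ω in (G n)ᶜ, ‖w r ω‖ₑ ∂P ≤ ‖√(r : ℝ)‖ₑ * (c / 2) :=
      (hw.setLIntegral_enorm_le r _).trans (mul_le_mul_right hn _)
    have h3 : ‖√(r : ℝ)‖ₑ * (c / 2) ≠ ∞ := ENNReal.mul_ne_top enorm_ne_top hctop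
    refine (ENNReal.add_le_add_iff_right h3).1 ?_
    rw [h1]
    exact add_le_add le_rfl h2
  have hupper : ∫⁻ ω in G n, Y n ω ∂P ≤ c / 2 * ε := by
    refine (setLIntegral_mono' (g := fun _ => c / 2 * ε) (hG n) fun ω hω => hω).trans ?_
    rw [setLIntegral_const]
    exact mul_le_of_le_one_right' prob_le_one
  have hmeas := stronglyMeasurable_sqrt_smul hD
  refine absurd hupper (not_le.2 ?_)
  calc c / 2 * ε < c / 2 * ∫⁻ r in B n, ‖φ n (√(r : ℝ) • D r)‖ₑ ∂(lebesgueOn T) :=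
        (ENNReal.mul_lt_mul_iff_right hc0 hctop).2 (hBφ n)
    _ = ∫⁻ r in B n, c / 2 * ‖φ n (√(r : ℝ) • D r)‖ₑ ∂(lebesgueOn T) :=
        (lintegral_const_mul _ (hmeas.dual_apply (φ n)).enorm).symm
    _ ≤ ∫⁻ r in B n, (∫⁻ ω in G n, ‖w r ω‖ₑ ∂P) * ‖φ n (D r)‖ₑ ∂(lebesgueOn T) := by
        refine lintegral_mono fun r => ?_
        simp only [map_smul, smul_eq_mul, enorm_mul]
        rw [← mul_assoc, mul_comm (c / 2)]
        exact mul_le_mul_left (hlower r) _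
    _ = ∫⁻ ω in G n, Y n ω ∂P := (hw.lintegral_lintegral_enorm hD (φ n) _ _).symm

theorem integrable_mul_dual_apply [IsProbabilityMeasure P] (hw : IsBrownianMotion w P)
    (hD : StronglyMeasurable D)
    (h : DualUniformlyIntegrable (lebesgueOn T) fun r => √(r : ℝ) • D r) (φ : StrongDual ℝ X) :
    Integrable (fun p : Ω × Icc (0 : ℝ) T => w p.2 p.1 * φ (D p.2)) (P.prod (lebesgueOn T)) := by
  have hsm := hw.stronglyMeasurable_mul_dual_apply hD φ
  refine ⟨hsm.aestronglyMeasurable, ?_⟩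
  rw [HasFiniteIntegral, lintegral_prod _ hsm.enorm.aemeasurable]
  have h0 := hw.lintegral_lintegral_enorm_le hD φ univ univ
  simp only [Measure.restrict_univ] at h0
  refine h0.trans_lt ?_
  have h1 := (memLp_id_gaussianReal (μ := 0) (v := 1) 2).eLpNorm_lt_top
  have h2 := (h.integrable_dual_apply (stronglyMeasurable_sqrt_smul hD) φ).2
  refine ENNReal.mul_lt_top (ENNReal.mul_lt_top h1 ?_) h2
  exact ENNReal.rpow_lt_top_of_nonneg (by norm_num) (measure_ne_top P univ)

theorem setIntegral_setIntegral_swap [IsProbabilityMeasure P] (hw : IsBrownianMotion w P)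
    (hD : StronglyMeasurable D)
    (h : DualUniformlyIntegrable (lebesgueOn T) fun r => √(r : ℝ) • D r)
    (φ : StrongDual ℝ X) (E : Set Ω) (B : Set (Icc (0 : ℝ) T)) :
    ∫ ω in E, ∫ r in B, w r ω * φ (D r) ∂(lebesgueOn T) ∂P =
      ∫ r in B, (∫ ω in E, w r ω ∂P) * φ (D r) ∂(lebesgueOn T) := by
  rw [integral_integral_swap]
  · exact integral_congr_ae (Eventually.of_forall fun r => integral_mul_const _ _)
  · rw [Measure.prod_restrict]
    exact (hw.integrable_mul_dual_apply hD h φ).integrableOn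

theorem integrable_setIntegral_mul_dual_apply [IsProbabilityMeasure P]
    (hw : IsBrownianMotion w P) (hD : StronglyMeasurable D)
    (h : DualUniformlyIntegrable (lebesgueOn T) fun r => √(r : ℝ) • D r)
    (φ : StrongDual ℝ X) (E : Set Ω) :
    Integrable (fun r => (∫ ω in E, w r ω ∂P) * φ (D r)) (lebesgueOn T) := by
  have h1 : Integrable (fun p : Ω × Icc (0 : ℝ) T => w p.2 p.1 * φ (D p.2))
      ((P.restrict E).prod (lebesgueOn T)) :=
    (hw.integrable_mul_dual_apply hD h φ).mono_measure
      (Measure.prod_mono Measure.restrict_le_self le_rfl)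
  exact h1.integral_prod_right.congr
    (Eventually.of_forall fun r => integral_mul_const (φ (D r)) (w r))

/-- Pathwise weak integrals `Z ω` of `w r ω • D r` are uniformly integrable over the dual ball: by
Tonelli and Cauchy–Schwarz, the integral of `|φ ∘ Z|` over an event `E` is of order `√(P E)`. -/
theorem dualUniformlyIntegrable_of_dual_apply_eq [IsProbabilityMeasure P]
    (hw : IsBrownianMotion w P)
    (hD : StronglyMeasurable D)
    (h : DualUniformlyIntegrable (lebesgueOn T) fun r => √(r : ℝ) • D r)
    {B : Set (Icc (0 : ℝ) T)} {Z : Ω → X}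
    (hZ : ∀ (φ : StrongDual ℝ X) ω, φ (Z ω) = ∫ r in B, w r ω * φ (D r) ∂(lebesgueOn T)) :
    DualUniformlyIntegrable P Z := by
  have hmeas := stronglyMeasurable_sqrt_smul hD
  obtain ⟨K, hK, hK'⟩ := h.exists_lintegral_le hmeas
  intro ε hε
  set C := eLpNorm id 2 (gaussianReal 0 1) with hC
  have hCtop : C ≠ ∞ := (memLp_id_gaussianReal (μ := 0) (v := 1) 2).eLpNorm_ne_top
  have hCK : C * K + 1 ≠ ∞ := by finiteness
  have hη : ε / (C * K + 1) ≠ 0 := (ENNReal.div_pos hε hCK).ne'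
  refine ⟨(ε / (C * K + 1)) ^ (2 : ℝ), ?_, fun E hE hEδ φ hφ => ?_⟩
  · rw [Ne, ENNReal.rpow_eq_zero_iff]
    push Not
    exact ⟨fun h0 => absurd h0 hη, fun _ => by norm_num⟩
  · have h1 : P E ^ (1 / 2 : ℝ) ≤ ε / (C * K + 1) := by
      refine (ENNReal.rpow_le_rpow hEδ (by norm_num)).trans_eq ?_
      rw [← ENNReal.rpow_mul]
      norm_num
    calc ∫⁻ ω in E, ‖φ (Z ω)‖ₑ ∂P
        ≤ ∫⁻ ω in E, ∫⁻ r in B, ‖w r ω * φ (D r)‖ₑ ∂(lebesgueOn T) ∂P :=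
          lintegral_mono fun ω => by
            rw [hZ]; exact enorm_integral_le_lintegral_enorm _
      _ ≤ C * P E ^ (1 / 2 : ℝ) * K :=
          (hw.lintegral_lintegral_enorm_le hD φ E B).trans (mul_le_mul_right (hK' φ hφ) _)
      _ = C * K * P E ^ (1 / 2 : ℝ) := by ring
      _ ≤ (C * K + 1) * (ε / (C * K + 1)) := mul_le_mul' le_self_add h1
      _ ≤ ε := ENNReal.mul_div_le

end IsBrownianMotion

end WeightedPaths

/-! ### The fundamental theorem of calculus on `[0, T]` -/

section FundamentalTheorem

variable {T : ℝ}

theorem lebesgueOn_map_val (T : ℝ) :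
    (lebesgueOn T).map Subtype.val = volume.restrict (Icc (0 : ℝ) T) :=
  map_comap_subtype_coe measurableSet_Icc volume

/-- An everywhere differentiable function with integrable derivative is the integral of its
derivative, here for the Lebesgue measure `lebesgueOn T` on the subtype `[0, T]`. -/
theorem setIntegral_Ioc_lebesgueOn_eq_sub {g g' : ℝ → ℝ} {s t : Icc (0 : ℝ) T} (hst : s ≤ t)
    (hg : ∀ x ∈ Icc (0 : ℝ) T, HasDerivWithinAt g (g' x) (Icc 0 T) x)
    (hint : IntegrableOn (fun r : Icc (0 : ℝ) T => g' r) (Ioc s t) (lebesgueOn T)) :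
    ∫ r in Ioc s t, g' r ∂(lebesgueOn T) = g t - g s := by
  have hemb : MeasurableEmbedding (Subtype.val : Icc (0 : ℝ) T → ℝ) :=
    MeasurableEmbedding.subtype_coe measurableSet_Icc
  have hpre : (Subtype.val : Icc (0 : ℝ) T → ℝ) ⁻¹' Ioc (s : ℝ) t = Ioc s t := rfl
  have hsub : Icc (s : ℝ) t ⊆ Icc 0 T := Icc_subset_Icc s.2.1 t.2.2
  have hres : (volume.restrict (Icc (0 : ℝ) T)).restrict (Ioc (s : ℝ) t) =
      volume.restrict (Ioc (s : ℝ) t) := by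
    rw [Measure.restrict_restrict measurableSet_Ioc,
      inter_eq_left.2 (Ioc_subset_Icc_self.trans hsub)]
  have h1 : ∫ r in Ioc s t, g' r ∂(lebesgueOn T) = ∫ x in (s : ℝ)..t, g' x := by
    rw [intervalIntegral.integral_of_le hst, ← hpre, ← hemb.setIntegral_map, lebesgueOn_map_val,
      hres]
  have h2 : IntervalIntegrable g' volume s t := by
    rw [intervalIntegrable_iff_integrableOn_Ioc_of_le hst, IntegrableOn, ← hres,
      ← lebesgueOn_map_val]
    change IntegrableOn g' _ _
    rw [hemb.integrableOn_map_iff, hpre]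
    exact hint
  rw [h1]
  refine intervalIntegral.integral_eq_sub_of_hasDerivAt_of_le hst
    (fun x hx => ((hg x (hsub hx)).continuousWithinAt.mono hsub)) (fun x hx => ?_) h2
  exact (hg x (hsub (Ioo_subset_Icc_self hx))).hasDerivAt
    (Icc_mem_nhds (s.2.1.trans_lt hx.1) (hx.2.trans_le t.2.2))

end FundamentalTheorem

/-! ### Pathwise Birkhoff integrals -/

section BirkhoffPaths

variable {Ω X : Type*} {mΩ : MeasurableSpace Ω} [NormedAddCommGroup X] [NormedSpace ℝ X]
  {P : Measure Ω} {T : ℝ} {w : Icc (0 : ℝ) T → Ω → ℝ}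
  {D : Icc (0 : ℝ) T → X}

theorem DualUniformlyIntegrable.dual_birkhoffIntegral [CompleteSpace X] {α : Type*}
    [MeasurableSpace α] [Nonempty α] {ν : Measure α} [IsFiniteMeasure ν] {f : α → X}
    (hf : StronglyMeasurable f) (h : DualUniformlyIntegrable ν f) {A : Set α}
    (hA : MeasurableSet A) (φ : StrongDual ℝ X) :
    φ (birkhoffIntegral ν f A) = ∫ y in A, φ (f y) ∂ν := by
  obtain ⟨J, hJ, hJφ⟩ := h.exists_hasBirkhoffIntegral hf hA
  rw [hJ.birkhoffIntegral_eq, hJφ]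

theorem DualUniformlyIntegrable.birkhoffIntegral_mem_closure_span [CompleteSpace X] {α : Type*}
    [MeasurableSpace α] [Nonempty α] {ν : Measure α} [IsFiniteMeasure ν] {f : α → X}
    (hf : StronglyMeasurable f)
    (h : DualUniformlyIntegrable ν f) {A : Set α} (hA : MeasurableSet A) :
    birkhoffIntegral ν f A ∈ closure (Submodule.span ℝ (range f) : Set X) := by
  obtain ⟨J, hJ, -⟩ := h.exists_hasBirkhoffIntegral hf hA
  rw [hJ.birkhoffIntegral_eq]
  exact hJ.mem_closure_span

/-- Conditional expectations in the Birkhoff sense can be checked weakly, by Hahn–Banach. -/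
theorem isBirkhoffCondExp_of_setIntegral_eq {Ω X : Type*} [NormedAddCommGroup X]
    [NormedSpace ℝ X] [CompleteSpace X] {m mΩ : MeasurableSpace Ω} {P : Measure Ω} [Nonempty Ω]
    [IsFiniteMeasure P] (hm : m ≤ mΩ) {f g : Ω → X} (hf : StronglyMeasurable f)
    (hg : StronglyMeasurable[m] g) (hf' : DualUniformlyIntegrable P f)
    (hg' : DualUniformlyIntegrable P g)
    (h : ∀ (φ : StrongDual ℝ X) E, MeasurableSet[m] E →
      ∫ ω in E, φ (f ω) ∂P = ∫ ω in E, φ (g ω) ∂P) :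
    IsBirkhoffCondExp m P f g where
  integrable_left := (hf'.exists_hasBirkhoffIntegral hf MeasurableSet.univ).imp fun _ h => h.1
  stronglyMeasurable := hg
  integrable_right :=
    (hg'.exists_hasBirkhoffIntegral (hg.mono hm) MeasurableSet.univ).imp fun _ h => h.1
  integral_eq E hE := by
    refine (SeparatingDual.eq_iff_forall_dual_eq (R := ℝ)).2 fun φ => ?_
    rw [hf'.dual_birkhoffIntegral hf (hm E hE), hg'.dual_birkhoffIntegral (hg.mono hm) (hm E hE),
      h φ E hE]

/-- The pathwise Birkhoff integral `∫₀ᵗ w r • D r dr`. The domain of integration is written `Iic t`,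
which is `[0, t]` in the time interval `[0, T]`. -/
noncomputable def pathIntegral (w : Icc (0 : ℝ) T → Ω → ℝ) (D : Icc (0 : ℝ) T → X)
    (t : Icc (0 : ℝ) T) (ω : Ω) : X :=
  birkhoffIntegral (lebesgueOn T) (fun r => w r ω • D r) (Iic t)

namespace IsBrownianMotion

theorem stronglyMeasurable_smul (hw : IsBrownianMotion w P) (hD : StronglyMeasurable D) (ω : Ω) :
    StronglyMeasurable fun r => w r ω • D r :=
  (hw.continuous_paths ω).measurable.stronglyMeasurable.smul hD

theorem dual_pathIntegral [CompleteSpace X] (hw : IsBrownianMotion w P) (hD : StronglyMeasurable D)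
    (h : ∀ ω, DualUniformlyIntegrable (lebesgueOn T) fun r => w r ω • D r)
    (φ : StrongDual ℝ X) (t : Icc (0 : ℝ) T) (ω : Ω) :
    φ (pathIntegral w D t ω) = ∫ r in Iic t, w r ω * φ (D r) ∂(lebesgueOn T) := by
  have : Nonempty (Icc (0 : ℝ) T) := ⟨t⟩
  rw [pathIntegral, (h ω).dual_birkhoffIntegral (hw.stronglyMeasurable_smul hD ω) measurableSet_Iic]
  simp

theorem isSeparable_range_pathIntegral [CompleteSpace X] (hw : IsBrownianMotion w P)
    (hD : StronglyMeasurable D)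
    (h : ∀ ω, DualUniformlyIntegrable (lebesgueOn T) fun r => w r ω • D r) :
    TopologicalSpace.IsSeparable
      (range fun p : Icc (0 : ℝ) T × Ω => pathIntegral w D p.1 p.2) := by
  refine ((hD.isSeparable_range.span (R := ℝ)).closure).mono ?_
  rintro _ ⟨⟨t, ω⟩, rfl⟩
  have : Nonempty (Icc (0 : ℝ) T) := ⟨t⟩
  refine closure_mono (Submodule.span_le.2 ?_) ((h ω).birkhoffIntegral_mem_closure_span
    (hw.stronglyMeasurable_smul hD ω) measurableSet_Iic)
  rintro _ ⟨r, rfl⟩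
  exact Submodule.smul_mem _ _ (Submodule.subset_span (mem_range_self r))

theorem stronglyMeasurable_uncurry_pathIntegral [CompleteSpace X] (hw : IsBrownianMotion w P)
    (hD : StronglyMeasurable D)
    (h : ∀ ω, DualUniformlyIntegrable (lebesgueOn T) fun r => w r ω • D r) :
    StronglyMeasurable fun p : Icc (0 : ℝ) T × Ω => pathIntegral w D p.1 p.2 := by
  refine stronglyMeasurable_of_dual_apply (hw.isSeparable_range_pathIntegral hD h) fun φ => ?_
  have h1 : ∀ p : Icc (0 : ℝ) T × Ω, φ (pathIntegral w D p.1 p.2) =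
      ∫ r, {q : (Icc (0 : ℝ) T × Ω) × Icc (0 : ℝ) T | q.2 ≤ q.1.1}.indicator
        (fun q => w q.2 q.1.2 * φ (D q.2)) (p, r) ∂(lebesgueOn T) := fun p => by
    rw [hw.dual_pathIntegral hD h, ← integral_indicator measurableSet_Iic]
    rfl
  simp only [h1]
  refine (StronglyMeasurable.integral_prod_right' (StronglyMeasurable.indicator ?_ ?_)).measurable
  · exact (hw.stronglyMeasurable_mul_dual_apply hD φ).comp_measurable
      (measurable_fst.snd.prodMk measurable_snd)
  · exact measurableSet_le measurable_snd measurable_fst.fst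

/-- On `[0, t]` the path may be stopped at `t`, which makes the integral depend on the past only. -/
theorem stronglyMeasurable_naturalFiltration_pathIntegral [CompleteSpace X]
    (hw : IsBrownianMotion w P)
    (hD : StronglyMeasurable D)
    (h : ∀ ω, DualUniformlyIntegrable (lebesgueOn T) fun r => w r ω • D r)
    (t : Icc (0 : ℝ) T) :
    StronglyMeasurable[hw.naturalFiltration t] (pathIntegral w D t) := by
  refine stronglyMeasurable_of_dual_apply ((hw.isSeparable_range_pathIntegral hD h).mono ?_)
    fun φ => ?_
  · rintro _ ⟨ω, rfl⟩
    exact ⟨(t, ω), rfl⟩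
  have h1 : ∀ ω, φ (pathIntegral w D t ω) =
      ∫ r, w (min r t) ω * φ (D r) ∂((lebesgueOn T).restrict (Iic t)) := fun ω => by
    rw [hw.dual_pathIntegral hD h]
    refine setIntegral_congr_fun measurableSet_Iic fun r hr => ?_
    rw [min_eq_left (mem_Iic.1 hr)]
  simp only [h1]
  have h2 : StronglyMeasurable[Prod.instMeasurableSpace (m₁ := hw.naturalFiltration t)]
      fun p : Ω × Icc (0 : ℝ) T => w (min p.2 t) p.1 * φ (D p.2) := by
    refine StronglyMeasurable.mul ?_ ((hD.dual_apply φ).comp_measurable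
      (@measurable_snd _ _ (hw.naturalFiltration t) _))
    exact ((hw.measurable_uncurry_stopped t).comp
      (@measurable_swap _ _ (hw.naturalFiltration t) _)).stronglyMeasurable
  exact (@StronglyMeasurable.integral_prod_right' _ _ _ (hw.naturalFiltration t) _ _ _ _ _ _
    h2).measurable

end IsBrownianMotion

end BirkhoffPaths

/-! ### The martingale property -/

section Drift

variable {Ω X : Type*} {mΩ : MeasurableSpace Ω} [NormedAddCommGroup X] [NormedSpace ℝ X]
  [CompleteSpace X] {P : Measure Ω} [IsProbabilityMeasure P] {T : ℝ}
  {w : Icc (0 : ℝ) T → Ω → ℝ} {D : Icc (0 : ℝ) T → X}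

namespace IsBrownianMotion

/-- By Fubini, the left-hand side is the integral over `(s, t]` of `(∫_E w r) * φ (Φ' r)`. The first
factor is `∫_E w s`, because `w` is a martingale, and the fundamental theorem of calculus integrates
the second. -/
theorem setIntegral_dual_pathIntegral_sub (hw : IsBrownianMotion w P) {Φ : ℝ → X}
    (hD : StronglyMeasurable fun r : Icc (0 : ℝ) T => derivWithin Φ (Icc 0 T) r)
    (hΦ : DifferentiableOn ℝ Φ (Icc 0 T))
    (h : ∀ ω, DualUniformlyIntegrable (lebesgueOn T)
      fun r => w r ω • derivWithin Φ (Icc 0 T) (r : ℝ))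
    {s t : Icc (0 : ℝ) T} (hst : s ≤ t) {E : Set Ω}
    (hE : MeasurableSet[hw.naturalFiltration s] E) (φ : StrongDual ℝ X) :
    ∫ ω in E, φ (pathIntegral w (fun r => derivWithin Φ (Icc 0 T) (r : ℝ)) t ω) ∂P -
      ∫ ω in E, φ (pathIntegral w (fun r => derivWithin Φ (Icc 0 T) (r : ℝ)) s ω) ∂P =
    (∫ ω in E, w s ω ∂P) * (φ (Φ t) - φ (Φ s)) := by
  set D : Icc (0 : ℝ) T → X := fun r => derivWithin Φ (Icc 0 T) (r : ℝ) with hDdef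
  have hsqrt := hw.dualUniformlyIntegrable_sqrt_smul hD h
  have hφint := hsqrt.integrable_dual_apply (stronglyMeasurable_sqrt_smul hD) φ
  have hmint := hw.integrable_setIntegral_mul_dual_apply hD hsqrt φ E
  simp only [hw.dual_pathIntegral hD h]
  rw [hw.setIntegral_setIntegral_swap hD hsqrt, hw.setIntegral_setIntegral_swap hD hsqrt,
    ← Iic_union_Ioc_eq_Iic hst, setIntegral_union (Iic_disjoint_Ioc le_rfl) measurableSet_Ioc
      hmint.integrableOn hmint.integrableOn, add_sub_cancel_left]
  have h1 : ∫ r in Ioc s t, (∫ ω in E, w r ω ∂P) * φ (D r) ∂(lebesgueOn T) =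
      (∫ ω in E, w s ω ∂P) * ∫ r in Ioc s t, φ (D r) ∂(lebesgueOn T) := by
    rw [← integral_const_mul]
    exact setIntegral_congr_fun measurableSet_Ioc fun r hr => by
      simp only [hw.setIntegral_eq hr.1.le hE]
  rw [h1]
  rcases eq_or_lt_of_le s.2.1 with hs | hs
  -- for `s = 0` the derivative need not be integrable near `0`, but the factor `∫ w 0` vanishes
  · have h0 : ∫ ω in E, w s ω ∂P = 0 :=
      integral_eq_zero_of_ae (ae_restrict_of_ae (hw.start s hs.symm))
    rw [h0, zero_mul, zero_mul]
  · rw [setIntegral_Ioc_lebesgueOn_eq_sub (g := fun x => φ (Φ x))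
      (g' := fun x => φ (derivWithin Φ (Icc 0 T) x)) hst]
    · exact fun x hx => φ.hasFDerivAt.comp_hasDerivWithinAt x (hΦ x hx).hasDerivWithinAt
    -- `√r • D r` is weakly integrable, and `√r ≥ √s > 0` on `(s, t]`
    · refine Integrable.mono' ((hφint.norm.const_mul (√(s : ℝ))⁻¹).integrableOn)
        (hD.dual_apply φ).aestronglyMeasurable ?_
      refine (ae_restrict_iff' measurableSet_Ioc).2 (Eventually.of_forall fun r hr => ?_)
      have hsr : √(s : ℝ) ≤ √(r : ℝ) := Real.sqrt_le_sqrt hr.1.le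
      rw [map_smul, norm_smul, Real.norm_of_nonneg (Real.sqrt_nonneg _), ← mul_assoc]
      refine le_mul_of_one_le_left (norm_nonneg _) ?_
      rw [inv_mul_eq_div, one_le_div (Real.sqrt_pos.2 hs)]
      exact hsr

end IsBrownianMotion

end Drift

theorem mainTheorem6 {Ω X : Type*} {mΩ : MeasurableSpace Ω} (P : Measure Ω)
    [IsProbabilityMeasure P] [NormedAddCommGroup X] [NormedSpace ℝ X] [CompleteSpace X]
    (T : ℝ) (hT : 0 < T) (w : Icc (0 : ℝ) T → Ω → ℝ) (hw : IsBrownianMotion w P)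
    (Φ : ℝ → X) (hΦ : BiStarIntegrable Φ w) (hΦ' : DualDifferentiable T Φ) :
    IsBirkhoffMartingale P hw.naturalFiltration
      (fun t ω => biStarIntegral Φ w ⟨0, left_mem_Icc.2 hT.le⟩ t ω) := by
  set o : Icc (0 : ℝ) T := ⟨0, left_mem_Icc.2 hT.le⟩ with ho
  have : Nonempty Ω := nonempty_of_isProbabilityMeasure P
  set D : Icc (0 : ℝ) T → X := fun r => derivWithin Φ (Icc 0 T) (r : ℝ) with hDdef
  have hD : StronglyMeasurable D :=
    stronglyMeasurable_derivWithin_Icc hT hΦ'.stronglyMeasurable hΦ.differentiableOn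
  have hui : ∀ ω, DualUniformlyIntegrable (lebesgueOn T) fun r => w r ω • D r := fun ω =>
    (hΦ.integrable ω).dualUniformlyIntegrable (hw.stronglyMeasurable_smul hD ω)
  have hsqrt := hw.dualUniformlyIntegrable_sqrt_smul hD hui
  have hA : ∀ t ω, biStarIntegral Φ w o t ω = w t ω • Φ t + -(w o ω • Φ o) +
      -pathIntegral w D t ω := fun t ω => by
    have h1 : Icc o t = Iic t := by
      ext r
      exact ⟨fun h => h.2, fun h => ⟨r.2.1, h⟩⟩
    rw [biStarIntegral, h1, sub_eq_add_neg, sub_eq_add_neg]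
    rfl
  simp only [hA]
  have hwint : ∀ t, Integrable (w t) P := fun t => (hw.memLp_two t).integrable one_le_two
  have hadapted : ∀ t, StronglyMeasurable[hw.naturalFiltration t]
      fun ω => w t ω • Φ t + -(w o ω • Φ o) + -pathIntegral w D t ω := fun t => by
    have hwt : ∀ r ≤ t, StronglyMeasurable[hw.naturalFiltration t] (w r) := fun r hr =>
      (Filtration.stronglyAdapted_natural
        fun t => (hw.measurable t).stronglyMeasurable).stronglyMeasurable_le hr
    exact (((hwt t le_rfl).smul_const _).add ((hwt o t.2.1).smul_const _).neg).add
      (hw.stronglyMeasurable_naturalFiltration_pathIntegral hD hui t).neg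
  have hmeas : ∀ t, StronglyMeasurable
      fun ω => w t ω • Φ t + -(w o ω • Φ o) + -pathIntegral w D t ω := fun t =>
    (hadapted t).mono (hw.naturalFiltration.le t)
  have huiA : ∀ t, DualUniformlyIntegrable P
      fun ω => w t ω • Φ t + -(w o ω • Φ o) + -pathIntegral w D t ω := fun t => by
    have hsm : ∀ r (x : X), StronglyMeasurable fun ω => w r ω • x := fun r x =>
      (hw.measurable r).stronglyMeasurable.smul_const x
    refine DualUniformlyIntegrable.add ((hsm _ _).add (hsm _ _).neg) (DualUniformlyIntegrable.add
      (hsm _ _) ((hwint t).smul_const _).dualUniformlyIntegrable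
      ((hwint o).smul_const _).dualUniformlyIntegrable.neg) (DualUniformlyIntegrable.neg ?_)
    exact hw.dualUniformlyIntegrable_of_dual_apply_eq hD hsqrt
      fun φ ω => hw.dual_pathIntegral hD hui φ t ω
  refine ⟨?_, hadapted, fun t => ?_, fun s t hst => ?_⟩
  · refine StronglyMeasurable.add (StronglyMeasurable.add ?_ ?_)
      (hw.stronglyMeasurable_uncurry_pathIntegral hD hui).neg
    · exact hw.measurable_uncurry.stronglyMeasurable.smul
        (hΦ'.stronglyMeasurable.comp_measurable measurable_fst)
    · exact (((hw.measurable o).comp measurable_snd).stronglyMeasurable.smul_const _).neg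
  · exact ((huiA t).exists_hasBirkhoffIntegral (hmeas t) MeasurableSet.univ).imp fun _ h => h.1
  -- weakly, the increment of `A` over `E` is `(∫ w s) * φ (Φ t - Φ s)` minus the same quantity
  · refine isBirkhoffCondExp_of_setIntegral_eq (hw.naturalFiltration.le s) (hmeas t) (hadapted s)
      (huiA t) (huiA s) fun φ E hE => ?_
    have hint : ∀ t, Integrable (fun ω => φ (pathIntegral w D t ω)) P := fun t =>
      (hw.dualUniformlyIntegrable_of_dual_apply_eq hD hsqrt
        fun φ ω => hw.dual_pathIntegral hD hui φ t ω).integrable_dual_apply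
        ((hw.stronglyMeasurable_naturalFiltration_pathIntegral hD hui t).mono
          (hw.naturalFiltration.le t)) φ
    have hexp : ∀ t, ∫ ω in E, φ (w t ω • Φ t + -(w o ω • Φ o) + -pathIntegral w D t ω) ∂P =
        (∫ ω in E, w t ω ∂P) * φ (Φ t) + -((∫ ω in E, w o ω ∂P) * φ (Φ o)) +
          -∫ ω in E, φ (pathIntegral w D t ω) ∂P := fun t => by
      simp only [map_add, map_neg, map_smul, smul_eq_mul]
      have h1 : ∀ r, IntegrableOn (fun ω => w r ω * φ (Φ r)) E P := fun r =>
        ((hwint r).mul_const _).integrableOn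
      have h2 : IntegrableOn (fun ω => -(w o ω * φ (Φ o))) E P := (h1 o).neg
      have h3 : IntegrableOn (fun ω => w t ω * φ (Φ t) + -(w o ω * φ (Φ o))) E P := (h1 t).add h2
      have h4 : IntegrableOn (fun ω => -φ (pathIntegral w D t ω)) E P := (hint t).neg.integrableOn
      rw [integral_add h3 h4, integral_add (h1 t) h2, integral_neg, integral_neg,
        integral_mul_const, integral_mul_const]
    rw [hexp, hexp, hw.setIntegral_eq hst hE]
    linarith [hw.setIntegral_dual_pathIntegral_sub hD hΦ.differentiableOn hui hst hE φ]
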